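/- **Setting.** An algebraic action $\sigma\colon S\curvearrowright A$ of a monoid $S$ on an Abelian group $A$ is a monoid homomorphism $s\mapsto\sigma_s$ from $S$ to the injective endomorphisms of $A$. Let $\mathcal C$ be the smallest family of subgroups of $A$ that contains $A$ and is closed under $C\mapsto\sigma_s C$ and $C\mapsto\sigma_s^{-1}C$ ($s\in S$), and let $\overline A=\varprojlim_{C\in\mathcal C}A/C$ (projective limit of discrete groups). A globalization of $\sigma$ is an action $\tilde\sigma\colon\mathscr S\to\mathrm{Aut}(\mathscr A)$ of a group $\mathscr S\supseteq S$ on an Abelian group $\mathscr A\supseteq A$ with $\tilde\sigma_s|_A=\sigma_s$ for $s\in S$; it is always assumed that $\mathscr S$ is generated by $S$ and that $\mathscr A$ is generated by $\bigcup_{s\in\mathscr S}\tilde\sigma_s(A)$. The group $\mathscr A\rtimes\mathscr S$ acts on $\mathscr A$ by $(z,\gamma).x=z+\tilde\sigma_\gamma(x)$; the partial bijections $A\cap g^{-1}.A\to g.A\cap A$, $x\mapsto g.x$, extend by continuity to a partial action of $\mathscr A\rtimes\mathscr S$ on $\overline A$ by partial homeomorphisms, and $(\mathscr A\rtimes\mathscr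 S)\ltimes\overline A$ denotes its transformation groupoid (pairs $(g,\boldsymbol x)$ with $\boldsymbol x$ in the domain of $g$, product $(g,h.\boldsymbol x)(h,\boldsymbol x)=(gh,\boldsymbol x)$, topology from $(\mathscr A\rtimes\mathscr S)\times\overline A$ with $\mathscr A\rtimes\mathscr S$ discrete). Standing assumptions: $S$ is non-trivial and left cancellative; $s\mapsto\sigma_s$ is injective; unless $S$ is a group, some $\sigma_s$ is not surjective; (FI) $\#(A/\sigma_sA)<\infty$ for all $s\in S$; (JF) if $C\in\mathcal C$, $g\in\mathscr S$ and $C\subseteq\ker(\mathrm{id}-\tilde\sigma_g)$, then $g=1$. **Conditions on** $\sigma\colon S\curvearrowright A$ relative to a second action $\tau\colon T\curvearrowright B$ with globalization $\tilde\tau\colon\mathscr T\curvearrowright\mathscr B$. Write $\dot\sigma_s=\mathrm{id}_{\mathbb Q}\otimes\sigma_s$ (restricted to $\mathbb Q\otimes P$ for a $\sigma_s$-invariant subgroup $P$ of $A$), and similarly $\dot\sigma_s=\mathrm{id}_{\mathbb Q}\otimes\tilde\sigma_s$ on $\mathbb Q\otimes\mathscr A$ for $s\in\mathscr S$. * (F)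 for $\tilde\tau$: $\mathrm{id}-\tilde\tau_t$ is injective on $\mathscr B$ for all $1\neq t\in\mathscr T$. * (PC): for every $C\in\mathcal C$ there is $s\in S$ with $\sigma_sA\subseteq C$. * (i$_1$) for a finite rank subgroup $P\subseteq A$: there is $s\in S$ with $\sigma_s(P)\subseteq P$ and $\mathrm{id}-\sigma_s$ injective on $P$, and every $2$-generated subgroup of $\mathscr T$ is free or Abelian. * (i$_2$): there is $s\in S$ with $\sigma_s=\kappa\,\mathrm{id}_A$ for some $\kappa\in\mathbb Z\setminus\{0,1\}$, and every $\alpha\in\mathscr T$ that is conjugate to $\alpha^\kappa$ in $\mathscr T$ is torsion. * (ii$_1$) for a finite rank subgroup $P\subseteq A$: for every torsion order $l>1$ of an element of $\mathscr T$ there are $1\neq s\in S$ with $\sigma_s(P)\subseteq P$ and coprime integers $\mu,\nu>0$ such that $\mu\det(z-\dot\sigma_s|_{\mathbb Q\otimes P})=\mu z^\delta-\nu$ for some $\delta$, and $\gcd(l,\mu)>1$ or $\gcd(l,\nu)>1$. * (ii$_2$): $\tilde\tau$ satisfies (F). * For an increasing sequence of finite rank subgroups $P_n$ with $A=\bigcup_nP_n$: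 (I) means that (i$_1$) holds for all $P_n$, or (i$_2$) holds; (II) means that (ii$_1$) holds for all $P_n$, or (ii$_2$) holds and $A$ is torsion-free. * (III): there is $s\in S$ with $\sigma_s=\kappa\,\mathrm{id}_A$ for some $\kappa\in\mathbb Z\setminus\{0,1\}$, $\mathscr B$ has finite rank, and $\tilde\tau$ satisfies (F). * $(*)$: either there is a sequence $(P_n)$ as above for which (I) and (II) hold, or (III) holds; in addition, $A$ is the union of an increasing sequence of finitely generated subgroups that are invariant under all $\sigma_s$, $s\in S$; $S$ and $T$ are right reversible (i.e. $Ss\cap St\neq\emptyset$ for all $s,t\in S$, and similarly for $T$); $\mathscr S=S^{-1}S$, $\mathscr A=S^{-1}A=\bigcup_{s\in S}\tilde\sigma_s^{-1}(A)$, $\mathscr T=T^{-1}T$, $\mathscr B=T^{-1}B=\bigcup_{t\in T}\tilde\tau_t^{-1}(B)$; and $\sigma$ satisfies (PC). (I$_s$) means that there is a sequence $(P_n)$ for which (I) holds, and that the same is true with the roles of $\sigma$ and $\tau$ exchanged; $(*_s)$ means that $(*)$ holds and that it holds with the roles exchanged. $\tilde\sigma$ (with $\mathscr A$ torsion-free of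 finite rank) satisfies (SF) if $\dot\sigma_s=\rho\dot\sigma_t\rho^{-1}$ with $s,t\in\mathscr S$ and $\rho\in\mathrm{Aut}(\mathbb Q\otimes\mathscr A)$ implies $s=t$. An embedding of a group action $\alpha\colon G\curvearrowright M$ into $\beta\colon H\curvearrowright N$ is a pair of injective group homomorphisms $\mathfrak t\colon G\to H$, $\mathfrak b\colon M\to N$ with $\mathfrak b(\alpha_g(x))=\beta_{\mathfrak t(g)}(\mathfrak b(x))$ for all $g\in G$, $x\in M$. It has finite index if $\mathfrak b(M)$ has finite index in $N$, it is full if $\mathfrak b$ is surjective, and strict if $\mathfrak t$ is an isomorphism. **Theorem.** Let $\sigma\colon S\curvearrowright A$ and $\tau\colon T\curvearrowright B$ be algebraic actions with globalizations $\tilde\sigma\colon\mathscr S\curvearrowright\mathscr A$ and $\tilde\tau\colon\mathscr T\curvearrowright\mathscr B$ satisfying the standing assumptions, with $\mathscr A$ and $\mathscr B$ torsion-free. Suppose that $(\mathscr A\rtimes\mathscr S)\ltimes\overline A\cong(\mathscr B\rtimes\mathscr T)\ltimes\overline B$ as topological groupoids. (i) If (I$_s$) holds, then each of $\dot\sigma\colon\mathscr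 S\curvearrowright\mathbb Q\otimes\mathscr A$ and $\dot\tau\colon\mathscr T\curvearrowright\mathbb Q\otimes\mathscr B$ embeds into the other. If, in addition, $\mathscr A$ and $\mathscr B$ have finite rank, then there are full embeddings of each of $\dot\sigma$, $\dot\tau$ into the other. If, moreover, $\tilde\sigma$ and $\tilde\tau$ both satisfy (SF), then there is a full and strict embedding of $\dot\sigma$ into $\dot\tau$, i.e. $\tilde\sigma$ and $\tilde\tau$ are isomorphic over $\mathbb Q$. (ii) If $(*_s)$ holds (so that $\mathscr S=S^{-1}S$, $\mathscr A=S^{-1}A$, $\mathscr T=T^{-1}T$, $\mathscr B=T^{-1}B$), then each of $\tilde\sigma$ and $\tilde\tau$ embeds into the other. If, in addition, $\mathscr A$ and $\mathscr B$ have finite rank, then there are finite index embeddings of each into the other. If, moreover, $\tilde\sigma$ and $\tilde\tau$ both satisfy (SF), then there are strict finite index embeddings of each into the other, i.e. $\tilde\sigma$ and $\tilde\tau$ are finitely algebraically equivalent. -/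

import Mathlib

open scoped TensorProduct Polynomial Topology

namespace AlgAct

noncomputable section

/-! ### Algebraic actions, constructible subgroups, completion -/

/-- An algebraic action of a monoid `S` on an abelian group `A`: a monoid homomorphism from `S` to
the injective endomorphisms of `A`. Subgroups of `A` are written as `ℤ`-submodules. -/
structure AlgebraicAction (S A : Type*) [Monoid S] [AddCommGroup A] where
  toEnd : S →* Module.End ℤ A
  injective : ∀ s, Function.Injective (toEnd s)

/-- The family `𝒞` of `S`-constructible subgroups of `A`: the smallest family containing `A` and
closed under images and preimages under the maps `σ_s`. -/
inductive Constructible {S A : Type*} [Monoid S] [AddCommGroup A] (σ : AlgebraicAction S A) :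
    Submodule ℤ A → Prop
  | top : Constructible σ ⊤
  | image (s : S) {C : Submodule ℤ A} (hC : Constructible σ C) :
      Constructible σ (C.map (σ.toEnd s))
  | preimage (s : S) {C : Submodule ℤ A} (hC : Constructible σ C) :
      Constructible σ (C.comap (σ.toEnd s))

/-- The completion `lim_{C ∈ 𝒞} A / C`: families `(x_C)` of classes, compatible under the
projections `A / C → A / D` for `C ≤ D`. -/
def Completion {S A : Type*} [Monoid S] [AddCommGroup A] (σ : AlgebraicAction S A) : Type _ :=
  {x : ∀ C : {C : Submodule ℤ A // Constructible σ C}, A ⧸ C.1 //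
    ∀ C D : {C : Submodule ℤ A // Constructible σ C}, C.1 ≤ D.1 →
      ∀ a : A, x C = Submodule.Quotient.mk a → x D = Submodule.Quotient.mk a}

/-- The projective limit topology (each `A / C` being discrete). -/
instance {S A : Type*} [Monoid S] [AddCommGroup A] (σ : AlgebraicAction S A) :
    TopologicalSpace (Completion σ) :=
  ⨅ C : {C : Submodule ℤ A // Constructible σ C},
    TopologicalSpace.induced (fun x : Completion σ => x.1 C) ⊥

/-! ### Globalizations and the affine group -/

/-- A globalization of `σ : S ↷ A`: a group `G` containing `S`, an abelian group `M` containing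
`A`, and an action of `G` on `M` by automorphisms which extends `σ`. It is minimal: `G` is
generated by `S` and `M` is generated by the translates of `A`. -/
structure Globalization {S A : Type*} [Monoid S] [AddCommGroup A] (σ : AlgebraicAction S A)
    (G M : Type*) [Group G] [AddCommGroup M] where
  ι : S →* G
  ι_injective : Function.Injective ι
  j : A →ₗ[ℤ] M
  j_injective : Function.Injective j
  act : G →* (M ≃ₗ[ℤ] M)
  act_ι : ∀ s a, act (ι s) (j a) = j (σ.toEnd s a)
  generates : Subgroup.closure (Set.range ι) = ⊤
  span_eq_top : Submodule.span ℤ {x : M | ∃ g a, x = act g (j a)} = ⊤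

/-- Automorphisms of the abelian group `M` as automorphisms of `M` written multiplicatively. -/
def autToMulAut (M : Type*) [AddCommGroup M] : (M ≃ₗ[ℤ] M) →* MulAut (Multiplicative M) where
  toFun f := AddEquiv.toMultiplicative f.toAddEquiv
  map_one' := rfl
  map_mul' _ _ := rfl

/-- The semidirect product `M ⋊ G`. -/
abbrev AffineGroup {G M : Type*} [Group G] [AddCommGroup M] (α : G →* (M ≃ₗ[ℤ] M)) : Type _ :=
  Multiplicative M ⋊[(autToMulAut M).comp α] G

/-- The affine action of `M ⋊ G` on `M`: `(z, γ).x = z + α_γ x`. -/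
def affine {G M : Type*} [Group G] [AddCommGroup M] (α : G →* (M ≃ₗ[ℤ] M))
    (g : AffineGroup α) (x : M) : M :=
  Multiplicative.toAdd g.left + α g.right x

theorem affine_one {G M : Type*} [Group G] [AddCommGroup M] (α : G →* (M ≃ₗ[ℤ] M)) (x : M) :
    affine α 1 x = x := by
  simp [affine]

theorem affine_mul {G M : Type*} [Group G] [AddCommGroup M] (α : G →* (M ≃ₗ[ℤ] M))
    (g h : AffineGroup α) (x : M) : affine α (g * h) x = affine α g (affine α h x) := by
  have : Multiplicative.toAdd (autToMulAut M (α g.right) h.left)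
      = α g.right (Multiplicative.toAdd h.left) := rfl
  simp [affine, add_assoc, this]

theorem affine_sub {G M : Type*} [Group G] [AddCommGroup M] (α : G →* (M ≃ₗ[ℤ] M))
    (g : AffineGroup α) (x y : M) : affine α g x - affine α g y = α g.right (x - y) := by
  simp [affine]

/-! ### Partial actions on spaces and their transformation groupoids -/

/-- A partial action of a (discrete) group `G` on a space `X` by partial homeomorphisms between
open subsets. The domain of `g` is `(θ g).source`. -/
structure PartialAction (G X : Type*) [Group G] [TopologicalSpace X] where
  toPH : G → OpenPartialHomeomorph X X
  one_source : (toPH 1).source = Set.univ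
  one_apply : ∀ x, toPH 1 x = x
  inv_eq : ∀ g, toPH g⁻¹ = (toPH g).symm
  mul_source : ∀ g h x, x ∈ (toPH h).source → toPH h x ∈ (toPH g).source →
    x ∈ (toPH (g * h)).source
  mul_apply : ∀ g h x, x ∈ (toPH h).source → toPH h x ∈ (toPH g).source →
    toPH (g * h) x = toPH g (toPH h x)

namespace PartialAction

variable {G X H Y : Type*} [Group G] [TopologicalSpace X] [Group H] [TopologicalSpace Y]

/-- The arrows of the partial transformation groupoid `G ⋉ X`: pairs `(g, x)` with `x` in the
domain of `g`. -/
def Arrow (θ : PartialAction G X) : Type _ :=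
  {p : G × X // p.2 ∈ (θ.toPH p.1).source}

/-- The topology inherited from `G × X` with `G` discrete. -/
instance (θ : PartialAction G X) : TopologicalSpace θ.Arrow :=
  TopologicalSpace.induced (Subtype.val : θ.Arrow → G × X)
    (@instTopologicalSpaceProd G X ⊥ _)

/-- The source of `(g, x)` is `x`. -/
def source {θ : PartialAction G X} (p : θ.Arrow) : X := p.1.2

/-- The range of `(g, x)` is `g.x`. -/
def range {θ : PartialAction G X} (p : θ.Arrow) : X := θ.toPH p.1.1 p.1.2

/-- The product `(g, h.x)(h, x) = (gh, x)` of composable arrows. -/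
def mul {θ : PartialAction G X} (p q : θ.Arrow) (h : source p = range q) : θ.Arrow :=
  ⟨(p.1.1 * q.1.1, q.1.2), θ.mul_source p.1.1 q.1.1 q.1.2 q.2 (by
    have h' : p.1.2 = θ.toPH q.1.1 q.1.2 := h
    exact h' ▸ p.2)⟩

/-- An isomorphism of topological groupoids between partial transformation groupoids: a
homeomorphism between the spaces of arrows which preserves and reflects composability and
preserves products (hence also units, inverses, sources and ranges). -/
structure GroupoidIso (θ : PartialAction G X) (η : PartialAction H Y) where
  toHomeomorph : θ.Arrow ≃ₜ η.Arrow
  composable_iff : ∀ p q : θ.Arrow,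
    source p = range q ↔ source (toHomeomorph p) = range (toHomeomorph q)
  map_mul : ∀ (p q : θ.Arrow) (h : source p = range q),
    toHomeomorph (mul p q h)
      = mul (toHomeomorph p) (toHomeomorph q) ((composable_iff p q).1 h)

end PartialAction

/-! ### The partial action of the affine group on the completion -/

section Extension

variable {S A G M : Type*} [Monoid S] [AddCommGroup A] [Group G] [AddCommGroup M]

theorem Constructible.inf {σ : AlgebraicAction S A} {C D : Submodule ℤ A}
    (hC : Constructible σ C) (hD : Constructible σ D) : Constructible σ (C ⊓ D) := by
  induction hC generalizing D with
  | top => simpa using hD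
  | @image s C hC ih =>
    have := Constructible.image s (ih (Constructible.preimage s hD))
    convert this using 1
    ext x
    simp only [Submodule.mem_inf, Submodule.mem_map, Submodule.mem_comap]
    constructor
    · rintro ⟨⟨y, hy, rfl⟩, h⟩
      exact ⟨y, ⟨hy, h⟩, rfl⟩
    · rintro ⟨y, ⟨hy, h⟩, rfl⟩
      exact ⟨⟨y, hy, rfl⟩, h⟩
  | @preimage s C hC ih =>
    have := Constructible.preimage s (ih (Constructible.image s hD))
    convert this using 1
    ext x
    simp only [Submodule.mem_inf, Submodule.mem_map, Submodule.mem_comap]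
    constructor
    · rintro ⟨h, hx⟩
      exact ⟨h, x, hx, rfl⟩
    · rintro ⟨h, y, hy, hyx⟩
      exact ⟨h, σ.injective s hyx ▸ hy⟩

variable {σ : AlgebraicAction S A}

/-- Every element of `G` maps small constructible subgroups into small constructible subgroups. -/
theorem Globalization.exists_small (Γ : Globalization σ G M) (g : G) :
    ∀ D : Submodule ℤ A, Constructible σ D → ∃ E : Submodule ℤ A, Constructible σ E ∧
      ∀ x ∈ E, ∃ y ∈ D, Γ.act g (Γ.j x) = Γ.j y := by
  have key : ∀ g ∈ Subgroup.closure (Set.range Γ.ι), (∀ D : Submodule ℤ A, Constructible σ D →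
      ∃ E : Submodule ℤ A, Constructible σ E ∧
        ∀ x ∈ E, ∃ y ∈ D, Γ.act g (Γ.j x) = Γ.j y) ∧
      (∀ D : Submodule ℤ A, Constructible σ D →
      ∃ E : Submodule ℤ A, Constructible σ E ∧
        ∀ x ∈ E, ∃ y ∈ D, Γ.act g⁻¹ (Γ.j x) = Γ.j y) := by
    intro g hg
    induction hg using Subgroup.closure_induction with
    | mem g hg =>
      obtain ⟨s, rfl⟩ := hg
      refine ⟨fun D hD => ⟨_, hD.preimage s, fun x hx => ⟨_, hx, Γ.act_ι s x⟩⟩,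
        fun D hD => ⟨_, hD.image s, ?_⟩⟩
      rintro x ⟨y, hy, rfl⟩
      refine ⟨y, hy, ?_⟩
      rw [← Γ.act_ι s y, ← LinearEquiv.mul_apply, ← map_mul]
      simp
    | one =>
      refine ⟨fun D hD => ⟨D, hD, fun x hx => ⟨x, hx, by simp⟩⟩,
        fun D hD => ⟨D, hD, fun x hx => ⟨x, hx, by simp⟩⟩⟩
    | mul g h _ _ ihg ihh =>
      constructor
      · intro D hD
        obtain ⟨E, hE, h1⟩ := ihg.1 D hD
        obtain ⟨F, hF, h2⟩ := ihh.1 E hE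
        refine ⟨F, hF, fun x hx => ?_⟩
        obtain ⟨y, hy, hxy⟩ := h2 x hx
        obtain ⟨z, hz, hyz⟩ := h1 y hy
        exact ⟨z, hz, by rw [map_mul, LinearEquiv.mul_apply, hxy, hyz]⟩
      · intro D hD
        obtain ⟨E, hE, h1⟩ := ihh.2 D hD
        obtain ⟨F, hF, h2⟩ := ihg.2 E hE
        refine ⟨F, hF, fun x hx => ?_⟩
        obtain ⟨y, hy, hxy⟩ := h2 x hx
        obtain ⟨z, hz, hyz⟩ := h1 y hy
        exact ⟨z, hz, by rw [mul_inv_rev, map_mul, LinearEquiv.mul_apply, hxy, hyz]⟩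
    | inv g _ ih => exact ⟨ih.2, by simpa using ih.1⟩
  exact (key g (by rw [Γ.generates]; trivial)).1

/-- `(x, y)` is a limit of pairs `(a, g.a)` with `a ∈ A` and `g.a ∈ A`: for every `C ∈ 𝒞` there is
such an `a` representing `x` modulo `C` such that `g.a` represents `y` modulo `C`. This is the
graph of the continuous extension to the completion of the partial bijection
`A ∩ g⁻¹.A → g.A ∩ A, a ↦ g.a`. -/
def Globalization.Rel (Γ : Globalization σ G M) (g : AffineGroup Γ.act) (x y : Completion σ) :
    Prop :=
  ∀ C : {C : Submodule ℤ A // Constructible σ C}, ∃ a b : A,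
    affine Γ.act g (Γ.j a) = Γ.j b ∧
      x.1 C = Submodule.Quotient.mk a ∧ y.1 C = Submodule.Quotient.mk b

theorem Completion.proj (x : Completion σ) {C D : {C : Submodule ℤ A // Constructible σ C}}
    (h : C.1 ≤ D.1) {a : A} (ha : x.1 C = Submodule.Quotient.mk a) :
    x.1 D = Submodule.Quotient.mk a := x.2 C D h a ha

theorem Globalization.affine_diff (Γ : Globalization σ G M) {g : AffineGroup Γ.act}
    {D E : Submodule ℤ A} (hE : ∀ x ∈ E, ∃ y ∈ D, Γ.act g.right (Γ.j x) = Γ.j y) {a b a' b' : A}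
    (h : affine Γ.act g (Γ.j a) = Γ.j b) (h' : affine Γ.act g (Γ.j a') = Γ.j b')
    (ha : (Submodule.Quotient.mk a : A ⧸ E) = Submodule.Quotient.mk a') :
    (Submodule.Quotient.mk b : A ⧸ D) = Submodule.Quotient.mk b' := by
  rw [Submodule.Quotient.eq] at ha ⊢
  obtain ⟨y, hy, hxy⟩ := hE _ ha
  have : Γ.j y = Γ.j (b - b') := by
    rw [← hxy, map_sub, map_sub Γ.j b b', ← h, ← h', affine_sub]
  rwa [← Γ.j_injective this]

theorem Globalization.rel_cont (Γ : Globalization σ G M) (g : AffineGroup Γ.act)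
    (D : {C : Submodule ℤ A // Constructible σ C}) :
    ∃ F : {C : Submodule ℤ A // Constructible σ C}, ∀ x y x' y' : Completion σ,
      Γ.Rel g x y → Γ.Rel g x' y' → x.1 F = x'.1 F → y.1 D = y'.1 D := by
  obtain ⟨E, hE, h⟩ := Γ.exists_small g.right D.1 D.2
  refine ⟨⟨E, hE⟩, fun x y x' y' hx hx' hxx => ?_⟩
  let F : {C : Submodule ℤ A // Constructible σ C} := ⟨E ⊓ D.1, hE.inf D.2⟩
  obtain ⟨a, b, hab, hxa, hyb⟩ := hx F
  obtain ⟨a', b', hab', hxa', hyb'⟩ := hx' F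
  rw [y.proj (D := D) inf_le_right hyb, y'.proj (D := D) inf_le_right hyb']
  rw [x.proj (D := ⟨E, hE⟩) inf_le_left hxa, x'.proj (D := ⟨E, hE⟩) inf_le_left hxa'] at hxx
  exact Γ.affine_diff h hab hab' hxx

theorem Globalization.rel_unique (Γ : Globalization σ G M) {g : AffineGroup Γ.act}
    {x y y' : Completion σ} (h : Γ.Rel g x y) (h' : Γ.Rel g x y') : y = y' := by
  refine Subtype.ext (funext fun D => ?_)
  obtain ⟨F, hF⟩ := Γ.rel_cont g D
  exact hF x y x y' h h' rfl

theorem Globalization.rel_symm (Γ : Globalization σ G M) {g : AffineGroup Γ.act}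
    {x y : Completion σ} (h : Γ.Rel g x y) : Γ.Rel g⁻¹ y x := fun C => by
  obtain ⟨a, b, hab, hx, hy⟩ := h C
  refine ⟨b, a, ?_, hy, hx⟩
  rw [← hab, ← affine_mul, inv_mul_cancel, affine_one]

theorem Globalization.rel_one (Γ : Globalization σ G M) (x : Completion σ) : Γ.Rel 1 x x :=
  fun C => by
    obtain ⟨a, ha⟩ := Submodule.Quotient.mk_surjective C.1 (x.1 C)
    exact ⟨a, a, affine_one _ _, ha.symm, ha.symm⟩

theorem Globalization.rel_mul (Γ : Globalization σ G M) {g h : AffineGroup Γ.act}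
    {x y z : Completion σ} (h1 : Γ.Rel h x y) (h2 : Γ.Rel g y z) : Γ.Rel (g * h) x z :=
  fun C => by
    obtain ⟨E, hE, hs⟩ := Γ.exists_small g.right C.1 C.2
    let F : {C : Submodule ℤ A // Constructible σ C} := ⟨E ⊓ C.1, hE.inf C.2⟩
    obtain ⟨a, b, hab, hxa, hyb⟩ := h1 F
    obtain ⟨b', c, hbc, hyb', hzc⟩ := h2 F
    have hd : b - b' ∈ E := by
      have : (Submodule.Quotient.mk b : A ⧸ F.1) = Submodule.Quotient.mk b' := by
        rw [← hyb, ← hyb']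
      exact ((Submodule.Quotient.eq _).1 this).1
    obtain ⟨d, hd, hbd⟩ := hs _ hd
    refine ⟨a, c + d, ?_, x.proj (D := C) inf_le_right hxa, ?_⟩
    · rw [affine_mul, hab, map_add, ← hbc, ← hbd, map_sub, ← affine_sub]
      abel
    · rw [z.proj (D := C) inf_le_right hzc, Submodule.Quotient.eq]
      simpa using hd

/-- The domain of `g` is the closure of `A ∩ g⁻¹.A`. -/
theorem Globalization.exists_rel (Γ : Globalization σ G M) {g : AffineGroup Γ.act}
    {x : Completion σ} (hx : ∀ C : {C : Submodule ℤ A // Constructible σ C}, ∃ a b : A,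
      affine Γ.act g (Γ.j a) = Γ.j b ∧ x.1 C = Submodule.Quotient.mk a) :
    ∃ y, Γ.Rel g x y := by
  choose E hE hs using fun D : {C : Submodule ℤ A // Constructible σ C} =>
    Γ.exists_small g.right D.1 D.2
  choose a b hab hxa using hx
  let e : {C : Submodule ℤ A // Constructible σ C} → {C : Submodule ℤ A // Constructible σ C} :=
    fun D => ⟨E D, hE D⟩
  have key : ∀ (D F : {C : Submodule ℤ A // Constructible σ C}) (a' b' : A),
      affine Γ.act g (Γ.j a') = Γ.j b' → x.1 F = Submodule.Quotient.mk a' → F.1 ≤ E D →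
      (Submodule.Quotient.mk (b (e D)) : A ⧸ D.1) = Submodule.Quotient.mk b' := by
    intro D F a' b' h' hF hFE
    refine Γ.affine_diff (hs D) (hab (e D)) h' ?_
    rw [← hxa (e D)]
    exact x.proj (D := e D) hFE hF
  refine ⟨⟨fun D => Submodule.Quotient.mk (b (e D)), fun C D hCD c hc => ?_⟩, fun C => ?_⟩
  · let F : {C : Submodule ℤ A // Constructible σ C} := ⟨E C ⊓ E D, (hE C).inf (hE D)⟩
    have := (key C F _ _ (hab F) (hxa F) inf_le_left).symm.trans hc
    refine (key D F _ _ (hab F) (hxa F) inf_le_right).trans ?_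
    rw [Submodule.Quotient.eq] at this ⊢
    exact hCD this
  · let F : {C : Submodule ℤ A // Constructible σ C} := ⟨E C ⊓ C.1, (hE C).inf C.2⟩
    exact ⟨a F, b F, hab F, x.proj (D := C) inf_le_right (hxa F),
      key C F _ _ (hab F) (hxa F) inf_le_left⟩

/-- The domain of `g` in the completion. -/
def Globalization.dom (Γ : Globalization σ G M) (g : AffineGroup Γ.act) : Set (Completion σ) :=
  {x | ∃ y, Γ.Rel g x y}

open Classical in
/-- The extension of `g` to its domain in the completion (the identity elsewhere). -/
def Globalization.ext (Γ : Globalization σ G M) (g : AffineGroup Γ.act) (x : Completion σ) :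
    Completion σ :=
  if h : ∃ y, Γ.Rel g x y then h.choose else x

theorem Globalization.rel_ext (Γ : Globalization σ G M) {g : AffineGroup Γ.act}
    {x : Completion σ} (h : x ∈ Γ.dom g) : Γ.Rel g x (Γ.ext g x) := by
  have h' : ∃ y, Γ.Rel g x y := h
  rw [Globalization.ext, dif_pos h']
  exact h'.choose_spec

theorem Globalization.ext_eq (Γ : Globalization σ G M) {g : AffineGroup Γ.act}
    {x y : Completion σ} (h : Γ.Rel g x y) : Γ.ext g x = y :=
  Γ.rel_unique (Γ.rel_ext ⟨y, h⟩) h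

theorem Completion.isOpen_fiber (C : {C : Submodule ℤ A // Constructible σ C}) (c : A ⧸ C.1) :
    IsOpen {x : Completion σ | x.1 C = c} := by
  have : IsOpen[TopologicalSpace.induced (fun x : Completion σ => x.1 C) ⊥]
      {x : Completion σ | x.1 C = c} := by
    let _ : TopologicalSpace (A ⧸ C.1) := ⊥
    exact ⟨{c}, trivial, rfl⟩
  exact iInf_le (fun C : {C : Submodule ℤ A // Constructible σ C} =>
    TopologicalSpace.induced (fun x : Completion σ => x.1 C) ⊥) C _ this

theorem Globalization.isOpen_dom (Γ : Globalization σ G M) (g : AffineGroup Γ.act) :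
    IsOpen (Γ.dom g) := by
  obtain ⟨E, hE, hs⟩ := Γ.exists_small g.right ⊤ Constructible.top
  rw [isOpen_iff_mem_nhds]
  rintro x ⟨y, hxy⟩
  refine Filter.mem_of_superset
    ((Completion.isOpen_fiber ⟨E, hE⟩ (x.1 ⟨E, hE⟩)).mem_nhds rfl) fun x' hx' => ?_
  obtain ⟨a, b, hab, hxa, -⟩ := hxy ⟨E, hE⟩
  refine Γ.exists_rel fun C => ?_
  let F : {C : Submodule ℤ A // Constructible σ C} := ⟨E ⊓ C.1, hE.inf C.2⟩
  obtain ⟨a', ha'⟩ := Submodule.Quotient.mk_surjective F.1 (x'.1 F)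
  have hd : a' - a ∈ E := by
    have h1 : x'.1 ⟨E, hE⟩ = Submodule.Quotient.mk a' :=
      x'.proj (D := ⟨E, hE⟩) inf_le_left ha'.symm
    have h2 : x'.1 ⟨E, hE⟩ = Submodule.Quotient.mk a := Eq.trans hx' hxa
    exact (Submodule.Quotient.eq _).1 (h1.symm.trans h2)
  obtain ⟨d, -, hd⟩ := hs _ hd
  refine ⟨a', b + d, ?_, x'.proj (D := C) inf_le_right ha'.symm⟩
  rw [map_add, ← hab, ← hd, map_sub, ← affine_sub]
  abel

theorem Globalization.continuousOn_ext (Γ : Globalization σ G M) (g : AffineGroup Γ.act) :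
    ContinuousOn (Γ.ext g) (Γ.dom g) := by
  intro x hx
  rw [ContinuousWithinAt, nhds_iInf, Filter.tendsto_iInf]
  intro D
  let _ : TopologicalSpace (A ⧸ D.1) := ⊥
  have _ : DiscreteTopology (A ⧸ D.1) := ⟨rfl⟩
  rw [nhds_induced, Filter.tendsto_comap_iff, nhds_discrete, Filter.tendsto_pure]
  obtain ⟨F, hF⟩ := Γ.rel_cont g D
  filter_upwards [self_mem_nhdsWithin, mem_nhdsWithin_of_mem_nhds
    ((Completion.isOpen_fiber F (x.1 F)).mem_nhds rfl)] with x' hx' hxF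
  exact hF x' _ x _ (Γ.rel_ext hx') (Γ.rel_ext hx) hxF

/-- The partial homeomorphism of the completion which extends the partial bijection
`A ∩ g⁻¹.A → g.A ∩ A, a ↦ g.a`. -/
def Globalization.partialHomeo (Γ : Globalization σ G M) (g : AffineGroup Γ.act) :
    OpenPartialHomeomorph (Completion σ) (Completion σ) where
  toFun := Γ.ext g
  invFun := Γ.ext g⁻¹
  source := Γ.dom g
  target := Γ.dom g⁻¹
  map_source' x hx := ⟨x, Γ.rel_symm (Γ.rel_ext hx)⟩
  map_target' x hx := ⟨x, by simpa using Γ.rel_symm (Γ.rel_ext hx)⟩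
  left_inv' x hx := Γ.ext_eq (Γ.rel_symm (Γ.rel_ext hx))
  right_inv' x hx := Γ.ext_eq (by simpa using Γ.rel_symm (Γ.rel_ext hx))
  open_source := Γ.isOpen_dom g
  open_target := Γ.isOpen_dom g⁻¹
  continuousOn_toFun := Γ.continuousOn_ext g
  continuousOn_invFun := Γ.continuousOn_ext g⁻¹

/-- The partial action of `M ⋊ G` on the completion of `A`. -/
def Globalization.partialAction (Γ : Globalization σ G M) :
    PartialAction (AffineGroup Γ.act) (Completion σ) where
  toPH := Γ.partialHomeo
  one_source := Set.eq_univ_of_forall fun x => ⟨x, Γ.rel_one x⟩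
  one_apply x := Γ.ext_eq (Γ.rel_one x)
  inv_eq g := by
    refine OpenPartialHomeomorph.ext _ _ (fun x => rfl) (fun x => ?_) rfl
    change Γ.ext g⁻¹⁻¹ x = Γ.ext g x
    rw [inv_inv]
  mul_source g h x hx hy := ⟨_, Γ.rel_mul (Γ.rel_ext hx) (Γ.rel_ext hy)⟩
  mul_apply g h x hx hy := Γ.ext_eq (Γ.rel_mul (Γ.rel_ext hx) (Γ.rel_ext hy))

end Extension

/-! ### Standing assumptions and further conditions -/

section Conditions

variable {S A G M T B H N : Type*} [Monoid S] [AddCommGroup A] [Group G] [AddCommGroup M]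
  [Monoid T] [AddCommGroup B] [Group H] [AddCommGroup N]

/-- The standing assumptions on `σ : S ↷ A` with globalization `Γ : G ↷ M`. -/
structure Standing {σ : AlgebraicAction S A} (Γ : Globalization σ G M) : Prop where
  nontrivial : Nontrivial S
  left_cancel : ∀ s t u : S, s * t = s * u → t = u
  faithful : Function.Injective σ.toEnd
  /-- Non-automorphic, unless `S` is a group. -/
  non_automorphic : (∀ s : S, IsUnit s) ∨ ∃ s, ¬ Function.Surjective (σ.toEnd s)
  /-- The finite index property (FI). -/
  finite_index : ∀ s, Finite (A ⧸ LinearMap.range (σ.toEnd s))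
  /-- Condition (JF). -/
  jf : ∀ (C : Submodule ℤ A), Constructible σ C → ∀ g ∈ Subgroup.closure (Set.range Γ.ι),
    (∀ x ∈ C, Γ.j x - Γ.act g (Γ.j x) = 0) → g = 1

/-- A (torsion-free) abelian group has finite rank. -/
def FiniteRank (M : Type*) [AddCommGroup M] : Prop := Module.Finite ℚ (ℚ ⊗[ℤ] M)

/-- Condition (PC): principal constructible subgroups are cofinal. -/
def CondPC (σ : AlgebraicAction S A) : Prop :=
  ∀ C : Submodule ℤ A, Constructible σ C → ∃ s, LinearMap.range (σ.toEnd s) ≤ C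

/-- Condition (F): `id - α_s` is injective for all `s ≠ 1`. -/
def CondF (α : G →* (M ≃ₗ[ℤ] M)) : Prop :=
  ∀ s : G, s ≠ 1 → Function.Injective fun x : M => x - α s x

/-- Every subgroup generated by two elements is free or abelian. -/
def TwoGenFreeOrAbelian (H : Type*) [Group H] : Prop :=
  ∀ x y : H, IsFreeGroup (Subgroup.closure ({x, y} : Set H)) ∨
    ∀ u v : Subgroup.closure ({x, y} : Set H), u * v = v * u

/-- Condition (i₁) for a finite rank subgroup `P` of `A`; `H` is the acting group of the
globalization of the other action. -/
def CondI1 (σ : AlgebraicAction S A) (H : Type*) [Group H] (P : Submodule ℤ A) : Prop :=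
  (∃ s : S, (∀ x ∈ P, σ.toEnd s x ∈ P) ∧ ∀ x ∈ P, x - σ.toEnd s x = 0 → x = 0) ∧
    TwoGenFreeOrAbelian H

/-- Condition (i₂). -/
def CondI2 (σ : AlgebraicAction S A) (H : Type*) [Group H] : Prop :=
  ∃ s : S, ∃ κ : ℤ, κ ≠ 0 ∧ κ ≠ 1 ∧ (∀ x, σ.toEnd s x = κ • x) ∧
    ∀ a : H, IsConj a (a ^ κ) → IsOfFinOrder a

/-- The characteristic polynomial `det(z - id_ℚ ⊗ f)` of an endomorphism `f` of a finite rank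
abelian group. -/
def ratCharpoly {P : Type*} [AddCommGroup P] (hP : FiniteRank P) (f : Module.End ℤ P) : ℚ[X] :=
  haveI : Module.Finite ℚ (ℚ ⊗[ℤ] P) := hP
  LinearMap.charpoly (LinearMap.baseChange ℚ f)

/-- Condition (ii₁) for a finite rank subgroup `P` of `A`. -/
def CondII1 (σ : AlgebraicAction S A) (H : Type*) [Group H] (P : Submodule ℤ A)
    (hP : FiniteRank P) : Prop :=
  ∀ l : ℕ, 1 < l → (∃ a : H, orderOf a = l) →
    ∃ s : S, s ≠ 1 ∧ ∃ μ ν : ℕ, 0 < μ ∧ 0 < ν ∧ Nat.Coprime μ ν ∧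
      ∃ hs : ∀ x ∈ P, σ.toEnd s x ∈ P,
        (∃ δ : ℕ, Polynomial.C (μ : ℚ) * ratCharpoly hP ((σ.toEnd s).restrict hs)
          = Polynomial.C (μ : ℚ) * Polynomial.X ^ δ - Polynomial.C (ν : ℚ)) ∧
        (1 < Nat.gcd l μ ∨ 1 < Nat.gcd l ν)

/-- `A` is the union of the increasing sequence `P` of subgroups. -/
def Exhausts (P : ℕ → Submodule ℤ A) : Prop :=
  Monotone P ∧ ∀ x : A, ∃ n, x ∈ P n

/-- Condition (I) for `σ`, relative to the family `P` of finite rank subgroups. -/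
def CondIFor (σ : AlgebraicAction S A) (H : Type*) [Group H] (P : ℕ → Submodule ℤ A) : Prop :=
  (∀ n, CondI1 σ H (P n)) ∨ CondI2 σ H

/-- Condition (II) for `σ` and the globalization `β : H ↷ N` of the other action, relative to the
family `P` of finite rank subgroups. -/
def CondIIFor (σ : AlgebraicAction S A) (β : H →* (N ≃ₗ[ℤ] N)) (P : ℕ → Submodule ℤ A)
    (hP : ∀ n, FiniteRank (P n)) : Prop :=
  (∀ n, CondII1 σ H (P n) (hP n)) ∨ (CondF β ∧ IsAddTorsionFree A)

/-- `A` is an increasing union of finite rank subgroups for which condition (I) holds. -/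
def CondI (σ : AlgebraicAction S A) (H : Type*) [Group H] : Prop :=
  ∃ P : ℕ → Submodule ℤ A, Exhausts P ∧ (∀ n, FiniteRank (P n)) ∧ CondIFor σ H P

/-- `A` is an increasing union of finite rank subgroups for which conditions (I) and (II) hold. -/
def CondIandII (σ : AlgebraicAction S A) (β : H →* (N ≃ₗ[ℤ] N)) : Prop :=
  ∃ P : ℕ → Submodule ℤ A, Exhausts P ∧ ∃ hP : ∀ n, FiniteRank (P n),
    CondIFor σ H P ∧ CondIIFor σ β P hP

/-- Condition (III). -/
def CondIII (σ : AlgebraicAction S A) (β : H →* (N ≃ₗ[ℤ] N)) : Prop :=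
  (∃ s : S, ∃ κ : ℤ, κ ≠ 0 ∧ κ ≠ 1 ∧ ∀ x, σ.toEnd s x = κ • x) ∧ FiniteRank N ∧ CondF β

/-- Right reversibility: `S s ∩ S t ≠ ∅` for all `s, t`. -/
def RightReversible (S : Type*) [Monoid S] : Prop :=
  ∀ s t : S, ∃ u v : S, u * s = v * t

/-- `G = S⁻¹ S` and `M = S⁻¹ A`. -/
def IsOreGlobalization {σ : AlgebraicAction S A} (Γ : Globalization σ G M) : Prop :=
  (∀ g : G, ∃ s t : S, g = (Γ.ι s)⁻¹ * Γ.ι t) ∧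
    ∀ x : M, ∃ (s : S) (a : A), x = Γ.act (Γ.ι s)⁻¹ (Γ.j a)

/-- Condition (∗) for `σ` relative to `τ`. -/
structure CondStar {σ : AlgebraicAction S A} {τ : AlgebraicAction T B}
    (Γ : Globalization σ G M) (Δ : Globalization τ H N) : Prop where
  cond : CondIandII σ Δ.act ∨ CondIII σ Δ.act
  exhaustion : ∃ P : ℕ → Submodule ℤ A, Exhausts P ∧ (∀ k, (P k).FG) ∧
    ∀ s k, (P k).map (σ.toEnd s) ≤ P k
  reversible_left : RightReversible S
  reversible_right : RightReversible T
  ore_left : IsOreGlobalization Γ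
  ore_right : IsOreGlobalization Δ
  pc : CondPC σ

/-- The symmetrized condition (I_s). -/
def CondIs {σ : AlgebraicAction S A} {τ : AlgebraicAction T B}
    (_ : Globalization σ G M) (_ : Globalization τ H N) : Prop :=
  CondI σ H ∧ CondI τ G

/-- The symmetrized condition (∗_s). -/
def CondStars {σ : AlgebraicAction S A} {τ : AlgebraicAction T B}
    (Γ : Globalization σ G M) (Δ : Globalization τ H N) : Prop :=
  CondStar Γ Δ ∧ CondStar Δ Γ

end Conditions

/-! ### Embeddings of actions -/

section Embeddings

variable {R G M H N : Type*} [CommRing R] [Group G] [AddCommGroup M] [Module R M] [Group H]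
  [AddCommGroup N] [Module R N]

/-- An embedding of `α : G ↷ M` into `β : H ↷ N`: injective group homomorphisms `G → H` and
`M → N` which are equivariant. -/
structure ActionEmbedding (α : G →* (M ≃ₗ[R] M)) (β : H →* (N ≃ₗ[R] N)) where
  grp : G →* H
  grp_injective : Function.Injective grp
  mod : M →+ N
  mod_injective : Function.Injective mod
  equivariant : ∀ s x, mod (α s x) = β (grp s) (mod x)

variable {α : G →* (M ≃ₗ[R] M)} {β : H →* (N ≃ₗ[R] N)}

/-- The embedding has finite index image. -/
def ActionEmbedding.IsFiniteIndex (e : ActionEmbedding α β) : Prop := e.mod.range.FiniteIndex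

/-- The embedding is surjective on the modules. -/
def ActionEmbedding.IsFull (e : ActionEmbedding α β) : Prop := Function.Surjective e.mod

/-- The embedding is an isomorphism on the groups. -/
def ActionEmbedding.IsStrict (e : ActionEmbedding α β) : Prop := Function.Bijective e.grp

variable (α β)

/-- Mutual embeddability. -/
def MutEmb : Prop := Nonempty (ActionEmbedding α β) ∧ Nonempty (ActionEmbedding β α)

/-- Mutual embeddability by embeddings of finite index. -/
def MutEmbFI : Prop :=
  (∃ e : ActionEmbedding α β, e.IsFiniteIndex) ∧ ∃ e : ActionEmbedding β α, e.IsFiniteIndex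

/-- Mutual embeddability by full embeddings. -/
def MutEmbFull : Prop :=
  (∃ e : ActionEmbedding α β, e.IsFull) ∧ ∃ e : ActionEmbedding β α, e.IsFull

/-- Finite algebraic equivalence: mutual embeddability by strict embeddings of finite index. -/
def FinitelyAlgEquiv : Prop :=
  (∃ e : ActionEmbedding α β, e.IsStrict ∧ e.IsFiniteIndex) ∧
    ∃ e : ActionEmbedding β α, e.IsStrict ∧ e.IsFiniteIndex

/-- Existence of a full and strict embedding. -/
def FullStrictEmb : Prop := ∃ e : ActionEmbedding α β, e.IsStrict ∧ e.IsFull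

end Embeddings

section Rational

variable {G M : Type*} [Group G] [AddCommGroup M]

/-- The action `s ↦ id_ℚ ⊗ α_s` of `G` on `ℚ ⊗ M`. -/
def rat (α : G →* (M ≃ₗ[ℤ] M)) : G →* ((ℚ ⊗[ℤ] M) ≃ₗ[ℚ] (ℚ ⊗[ℤ] M)) where
  toFun s := LinearEquiv.baseChange ℤ ℚ M M (α s)
  map_one' := by
    ext x
    simp
  map_mul' s t := by
    ext x
    induction x using TensorProduct.induction_on with
    | zero => simp
    | tmul q x => simp
    | add x y hx hy => rw [map_add, map_add, hx, hy]

/-- Condition (SF): strong faithfulness. -/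
def CondSF (α : G →* (M ≃ₗ[ℤ] M)) : Prop :=
  ∀ (s t : G) (ρ : (ℚ ⊗[ℤ] M) ≃ₗ[ℚ] (ℚ ⊗[ℤ] M)),
    rat α s = ρ * rat α t * ρ⁻¹ → s = t

end Rational

end

end AlgAct

open AlgAct

/-! The group component of an isomorphism of the transformation groupoids is a continuous cocycle
with values in `N ⋊ H`. Two pieces of it are used. The arrows `(g, 0)` give a homomorphism `lin : G
→ N ⋊ H`. The translations by `a ∈ A` give elements `trans a b`. By (FI) the completion is compact,
so for each `a` the locally constant map `b ↦ trans a b` is periodic modulo some constructible `C`.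
On the subgroup `stab C` of those `a ∈ C` whose cocycle is `C`-periodic, `a ↦ trans a 0` is
therefore a homomorphism. It is injective because only units are mapped to units, and continuity at
`0` gives `trans (g.a) 0 = lin g * trans a 0 * (lin g)⁻¹` for small `a`. Every `x ∈ M` has a nonzero
multiple in some `stab C`.

The crux is that the `H`-component of `trans a 0` is torsion (`TorsionTranslations`). Under (i₁), a
multiple of `a` is a difference `b - σ_s b`; the components of multiples of `b` and `σ_s b` commute
and are conjugate, hence equal in a free or abelian group. Under (i₂) or (III), a power of the
component is conjugate to its `κ`-th power; in case (III) such an element has a root of unity as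
eigenvalue on `ℚ ⊗ N`, and (F) makes it torsion. Multiples of `a` then land in `N`, and division
yields an injective map `M → ℚ ⊗ N`, equivariant along the `H`-component of `lin`
(`TorsionTranslations.exists_hom`).

For (ii), one shows that on small subgroups the `H`-component is trivial, not just torsion. Then
(PC) and equivariance force the values of the map into `N`
(`TorsionTranslations.nonempty_embedding`).

The inverse isomorphism gives embeddings in the other direction. In finite rank, mutual embeddings
are full over `ℚ` and of finite index over `ℤ`, and their composite conjugates `α_s` to the image of
`s`, so (SF) makes the group homomorphisms mutually inverse. -/

namespace AlgAct

noncomputable section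

/-! ### Compactness of the completion and locally constant functions on it -/

section Completion

variable {S A : Type*} [Monoid S] [AddCommGroup A] {σ : AlgebraicAction S A}

/-- Indices multiply under injective images, and the index of a preimage divides the original index.
-/
theorem Constructible.finite_quotient (hfi : ∀ s, Finite (A ⧸ LinearMap.range (σ.toEnd s)))
    {C : Submodule ℤ A} (hC : Constructible σ C) : Finite (A ⧸ C) := by
  suffices h : C.toAddSubgroup.FiniteIndex from
    AddSubgroup.finiteIndex_iff_finite_quotient.1 h
  induction hC with
  | top => exact inferInstanceAs (⊤ : AddSubgroup A).FiniteIndex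
  | @image s C hC ih =>
    have h1 : (LinearMap.range (σ.toEnd s)).toAddSubgroup.FiniteIndex :=
      AddSubgroup.finiteIndex_iff_finite_quotient.2 (hfi s)
    have h2 := AddSubgroup.index_map C.toAddSubgroup (σ.toEnd s).toAddMonoidHom
    have h3 : (C.toAddSubgroup ⊔ (σ.toEnd s).toAddMonoidHom.ker).FiniteIndex :=
      AddSubgroup.finiteIndex_of_le le_sup_left
    constructor
    change ((C.toAddSubgroup).map (σ.toEnd s).toAddMonoidHom).index ≠ 0
    rw [h2]
    exact mul_ne_zero h3.index_ne_zero h1.index_ne_zero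
  | @preimage s C hC ih =>
    constructor
    change (C.toAddSubgroup.comap (σ.toEnd s).toAddMonoidHom).index ≠ 0
    rw [AddSubgroup.index_comap]
    exact ne_zero_of_dvd_ne_zero ih.index_ne_zero
      (AddSubgroup.relIndex_dvd_index_of_normal _ _)

/-- Multiples of every element lie in a given constructible subgroup. -/
theorem Constructible.exists_nsmul_mem (hfi : ∀ s, Finite (A ⧸ LinearMap.range (σ.toEnd s)))
    {C : Submodule ℤ A} (hC : Constructible σ C) :
    ∃ n : ℕ, 0 < n ∧ ∀ a : A, n • a ∈ C := by
  have := hC.finite_quotient hfi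
  refine ⟨Nat.card (A ⧸ C), Nat.card_pos, fun a => ?_⟩
  rw [← Submodule.Quotient.mk_eq_zero, Submodule.Quotient.mk_smul]
  exact card_nsmul_eq_zero'

/-- The canonical map from `A` to its completion. -/
def Completion.of (σ : AlgebraicAction S A) (a : A) : Completion σ :=
  ⟨fun _ => Submodule.Quotient.mk a, fun C D h b hb => by
    rw [Submodule.Quotient.eq] at hb ⊢
    exact h hb⟩

theorem Completion.nhds_eq (x : Completion σ) :
    𝓝 x = ⨅ C : {C : Submodule ℤ A // Constructible σ C},
      Filter.principal {y : Completion σ | y.1 C = x.1 C} := by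
  rw [nhds_iInf]
  refine iInf_congr fun C => ?_
  let _ : TopologicalSpace (A ⧸ C.1) := ⊥
  have _ : DiscreteTopology (A ⧸ C.1) := ⟨rfl⟩
  have h : 𝓝 (x.1 C) = pure (x.1 C) := by rw [nhds_discrete]
  refine (nhds_induced _ x).trans ?_
  refine (congrArg (Filter.comap (fun x : Completion σ => x.1 C)) h).trans ?_
  rw [Filter.comap_pure]
  rfl

/-- Constructible subgroups are closed under intersection, so the fibres over the quotients `A / C`
form a neighbourhood base and not only a subbase. -/
theorem Completion.exists_nhds {x : Completion σ} {U : Set (Completion σ)} (hU : U ∈ 𝓝 x) :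
    ∃ C : {C : Submodule ℤ A // Constructible σ C}, ∀ y : Completion σ, y.1 C = x.1 C → y ∈ U := by
  rw [Completion.nhds_eq] at hU
  have : Nonempty {C : Submodule ℤ A // Constructible σ C} := ⟨⟨⊤, .top⟩⟩
  obtain ⟨C, hC⟩ := (Filter.mem_iInf_of_directed (fun C D => by
    refine ⟨⟨C.1 ⊓ D.1, C.2.inf D.2⟩, ?_, ?_⟩
    all_goals
      refine Filter.principal_mono.2 fun y hy => ?_
      obtain ⟨a, ha⟩ := Submodule.Quotient.mk_surjective _
        (x.1 (⟨C.1 ⊓ D.1, C.2.inf D.2⟩ : {C : Submodule ℤ A // Constructible σ C}))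
      have hy' : y.1 ⟨C.1 ⊓ D.1, C.2.inf D.2⟩ = Submodule.Quotient.mk a :=
        Eq.trans hy ha.symm
    · exact (y.proj (D := C) inf_le_left hy').trans (x.proj (D := C) inf_le_left ha.symm).symm
    · exact (y.proj (D := D) inf_le_right hy').trans
        (x.proj (D := D) inf_le_right ha.symm).symm) U).1 hU
  exact ⟨C, fun y hy => hC hy⟩

/-- By (FI) the completion sits in a product of finite discrete spaces, cut out by clopen
compatibility conditions. -/
theorem Completion.compactSpace (hfi : ∀ s, Finite (A ⧸ LinearMap.range (σ.toEnd s))) :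
    CompactSpace (Completion σ) := by
  let _ : ∀ C : {C : Submodule ℤ A // Constructible σ C}, TopologicalSpace (A ⧸ C.1) :=
    fun _ => ⊥
  have _ : ∀ C : {C : Submodule ℤ A // Constructible σ C}, DiscreteTopology (A ⧸ C.1) :=
    fun _ => ⟨rfl⟩
  have _ : ∀ C : {C : Submodule ℤ A // Constructible σ C}, Finite (A ⧸ C.1) :=
    fun C => C.2.finite_quotient hfi
  let X := ∀ C : {C : Submodule ℤ A // Constructible σ C}, A ⧸ C.1
  let val : Completion σ → X := fun x => x.1
  have hind : Topology.IsInducing val := by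
    constructor
    change (⨅ C : {C : Submodule ℤ A // Constructible σ C},
      TopologicalSpace.induced (fun x : Completion σ => x.1 C) ⊥) = _
    rw [Pi.topologicalSpace, induced_iInf]
    simp only [induced_compose]
    rfl
  have hcl : IsClosed (Set.range val) := by
    have : Set.range val =
        ⋂ (C) (D) (_ : C.1 ≤ D.1) (a : A),
          {x : X | x C = Submodule.Quotient.mk a → x D = Submodule.Quotient.mk a} := by
      ext x
      simp only [Set.mem_iInter]
      exact ⟨by rintro ⟨y, rfl⟩; exact y.2, fun h => ⟨⟨x, h⟩, rfl⟩⟩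
    rw [this]
    refine isClosed_iInter fun C => isClosed_iInter fun D => isClosed_iInter fun _ =>
      isClosed_iInter fun a => ?_
    have h : IsClopen {x : X | x C = Submodule.Quotient.mk a} :=
      (isClopen_discrete {(Submodule.Quotient.mk a : A ⧸ C.1)}).preimage (continuous_apply C)
    have h' : IsClopen {x : X | x D = Submodule.Quotient.mk a} :=
      (isClopen_discrete {(Submodule.Quotient.mk a : A ⧸ D.1)}).preimage (continuous_apply D)
    exact isClosed_imp h.isOpen h'.isClosed
  exact (Topology.IsClosedEmbedding.mk ⟨hind, fun _ _ h => Subtype.ext h⟩ hcl).compactSpace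

/-- Locally constant functions on the completion factor through some quotient `A / C`. -/
theorem Completion.exists_periodic (hfi : ∀ s, Finite (A ⧸ LinearMap.range (σ.toEnd s)))
    {Z : Type*} (f : Completion σ → Z) (hf : ∀ x, ∀ᶠ y in 𝓝 x, f y = f x) :
    ∃ C : {C : Submodule ℤ A // Constructible σ C}, ∀ x y, x.1 C = y.1 C → f x = f y := by
  have := Completion.compactSpace hfi
  choose C hC using fun x => Completion.exists_nhds (hf x)
  obtain ⟨t, ht⟩ := CompactSpace.elim_nhds_subcover
    (fun x => {y : Completion σ | y.1 (C x) = x.1 (C x)})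
    (fun x => (Completion.isOpen_fiber (C x) _).mem_nhds rfl)
  have hinf : ∀ t : Finset (Completion σ), ∃ D : {C : Submodule ℤ A // Constructible σ C},
      ∀ x ∈ t, D.1 ≤ (C x).1 := by
    classical
    intro t
    induction t using Finset.induction_on with
    | empty => exact ⟨⟨⊤, .top⟩, by simp⟩
    | insert x t _ ih =>
      obtain ⟨D, hD⟩ := ih
      refine ⟨⟨(C x).1 ⊓ D.1, (C x).2.inf D.2⟩, fun y hy => ?_⟩
      rcases Finset.mem_insert.1 hy with rfl | hy
      · exact inf_le_left
      · exact inf_le_right.trans (hD y hy)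
  obtain ⟨D, hD⟩ := hinf t
  refine ⟨D, fun x y hxy => ?_⟩
  have hx : x ∈ ⋃ z ∈ t, {y : Completion σ | y.1 (C z) = z.1 (C z)} := ht ▸ Set.mem_univ x
  simp only [Set.mem_iUnion, Set.mem_ofPred_eq] at hx
  obtain ⟨z, hz, hxz⟩ := hx
  obtain ⟨a, ha⟩ := Submodule.Quotient.mk_surjective _ (x.1 D)
  have hy : y.1 (C z) = z.1 (C z) := by
    rw [← hxz, x.proj (hD z hz) ha.symm, y.proj (hD z hz) (hxy.symm.trans ha.symm)]
  exact (hC z x hxz).trans (hC z y hy).symm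

end Completion

/-! ### The cocycle of a groupoid isomorphism -/

namespace PartialAction

variable {G X H Y : Type*} [Group G] [TopologicalSpace X] [Group H] [TopologicalSpace Y]
  {θ : PartialAction G X} {η : PartialAction H Y}

/-- The inverse of an isomorphism of transformation groupoids. -/
def GroupoidIso.symm (Φ : GroupoidIso θ η) : GroupoidIso η θ where
  toHomeomorph := Φ.toHomeomorph.symm
  composable_iff p q := by simp [Φ.composable_iff]
  map_mul p q h := by
    rw [Homeomorph.symm_apply_eq, Φ.map_mul]
    simp

/-- The group component of an isomorphism of transformation groupoids. -/
def GroupoidIso.cocycle (Φ : GroupoidIso θ η) (p : θ.Arrow) : H := (Φ.toHomeomorph p).1.1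

theorem GroupoidIso.cocycle_mul (Φ : GroupoidIso θ η) (p q : θ.Arrow) (h : source p = range q) :
    Φ.cocycle (mul p q h) = Φ.cocycle p * Φ.cocycle q := by
  simp only [GroupoidIso.cocycle, Φ.map_mul p q h]
  rfl

/-- An arrow with trivial group component is an idempotent; idempotents pull back along the
isomorphism, and an idempotent element of a group is trivial. -/
theorem GroupoidIso.eq_one_of_cocycle (Φ : GroupoidIso θ η) {p : θ.Arrow}
    (h : Φ.cocycle p = 1) : p.1.1 = 1 := by
  set q := Φ.toHomeomorph p with hq
  have hq1 : q.1.1 = 1 := h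
  have hs : source q = range q := by
    change q.1.2 = η.toPH q.1.1 q.1.2
    rw [hq1, η.one_apply]
  have hp : source p = range p := (Φ.composable_iff p p).2 hs
  have hm : mul p p hp = p := by
    apply Φ.toHomeomorph.injective
    rw [Φ.map_mul]
    refine Subtype.ext (Prod.ext ?_ rfl)
    change q.1.1 * q.1.1 = q.1.1
    rw [hq1, one_mul]
  have : p.1.1 * p.1.1 = p.1.1 := congrArg (fun r : θ.Arrow => r.1.1) hm
  simpa using this

/-- The cocycle is continuous into a discrete group, and for fixed `g` the arrow `(g, y)` depends
continuously on `y`. -/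
theorem GroupoidIso.cocycle_eventually (Φ : GroupoidIso θ η) (p : θ.Arrow) :
    ∀ᶠ y in 𝓝 p.1.2, ∀ hy : y ∈ (θ.toPH p.1.1).source,
      Φ.cocycle ⟨(p.1.1, y), hy⟩ = Φ.cocycle p := by
  let _ : TopologicalSpace G := ⊥
  have _ : DiscreteTopology G := ⟨rfl⟩
  let _ : TopologicalSpace H := ⊥
  have _ : DiscreteTopology H := ⟨rfl⟩
  have h1 : Topology.IsInducing (fun p : θ.Arrow => p.1) := ⟨rfl⟩
  have h2 : Topology.IsInducing (fun p : η.Arrow => p.1) := ⟨rfl⟩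
  have hc : Continuous Φ.cocycle :=
    continuous_fst.comp (h2.continuous.comp Φ.toHomeomorph.continuous)
  have hev : ∀ᶠ q in 𝓝 p, Φ.cocycle q = Φ.cocycle p := by
    have := hc.continuousAt (x := p)
    rw [ContinuousAt, nhds_discrete H, Filter.tendsto_pure] at this
    exact this
  have hev' := h1.nhds_eq_comap p ▸ hev
  rw [Filter.eventually_comap] at hev'
  have ht : Filter.Tendsto (fun y => (p.1.1, y)) (𝓝 p.1.2) (𝓝 p.1) :=
    (Continuous.prodMk continuous_const continuous_id).tendsto p.1.2
  filter_upwards [ht.eventually hev'] with y hy hys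
  exact hy ⟨(p.1.1, y), hys⟩ rfl

end PartialAction

/-! ### Restriction of the cocycle to translations and to the isotropy at `0` -/

section OrbitCocycle

variable {S A G M : Type*} [Monoid S] [AddCommGroup A] [Group G] [AddCommGroup M]

/-- The restriction of a groupoid cocycle with values in a group `K` to the translations by `A`
(at the points of `A`) and to the isotropy at `0`. -/
structure OrbitCocycle {σ : AlgebraicAction S A} (Γ : Globalization σ G M) (K : Type*)
    [Group K] where
  trans : A → A → K
  lin : G →* K
  trans_add : ∀ a a' b, trans (a + a') b = trans a (a' + b) * trans a' b
  eq_zero : ∀ a b, trans a b = 1 → a = 0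
  periodic : ∀ a, ∃ C, Constructible σ C ∧ ∀ b b', b - b' ∈ C → trans a b = trans a b'
  conj : ∀ g, ∃ C, Constructible σ C ∧ ∀ a ∈ C, ∀ a', Γ.act g (Γ.j a) = Γ.j a' →
    trans a' 0 * lin g = lin g * trans a 0

variable {σ : AlgebraicAction S A}

theorem Globalization.rel_of (Γ : Globalization σ G M) {g : AffineGroup Γ.act} {a b : A}
    (h : affine Γ.act g (Γ.j a) = Γ.j b) : Γ.Rel g (Completion.of σ a) (Completion.of σ b) :=
  fun _ => ⟨a, b, h, rfl, rfl⟩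

theorem Globalization.affine_inl (Γ : Globalization σ G M) (a b : A) :
    affine Γ.act (SemidirectProduct.inl (Multiplicative.ofAdd (Γ.j a))) (Γ.j b) = Γ.j (a + b) := by
  simp [affine]

theorem Globalization.affine_inr (Γ : Globalization σ G M) (g : G) (x : M) :
    affine Γ.act (SemidirectProduct.inr g) x = Γ.act g x := by
  simp [affine]

/-- Translations by `A` are defined on the whole completion, so compactness applies to their
cocycles. -/
theorem Globalization.mem_dom_inl (Γ : Globalization σ G M) (a : A) (x : Completion σ) :
    x ∈ Γ.dom (SemidirectProduct.inl (Multiplicative.ofAdd (Γ.j a))) :=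
  Γ.exists_rel fun C => by
    obtain ⟨b, hb⟩ := Submodule.Quotient.mk_surjective C.1 (x.1 C)
    exact ⟨b, a + b, Γ.affine_inl a b, hb.symm⟩

/-- The arrow `(g, a)` if `g.a ∈ A`. -/
def Globalization.arrow (Γ : Globalization σ G M) (g : AffineGroup Γ.act) (a : A)
    (h : ∃ b, affine Γ.act g (Γ.j a) = Γ.j b) : Γ.partialAction.Arrow :=
  ⟨(g, Completion.of σ a), Completion.of σ h.choose, Γ.rel_of h.choose_spec⟩

theorem Globalization.arrow_comp (Γ : Globalization σ G M) {g h : AffineGroup Γ.act} {a b c : A}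
    (hab : affine Γ.act h (Γ.j a) = Γ.j b) (hbc : affine Γ.act g (Γ.j b) = Γ.j c)
    {η : Type*} {Y : Type*} [Group η] [TopologicalSpace Y] {ρ : PartialAction η Y}
    (Φ : PartialAction.GroupoidIso Γ.partialAction ρ) :
    Φ.cocycle (Γ.arrow (g * h) a ⟨c, by rw [affine_mul, hab, hbc]⟩) =
      Φ.cocycle (Γ.arrow g b ⟨c, hbc⟩) * Φ.cocycle (Γ.arrow h a ⟨b, hab⟩) := by
  have hcomp : PartialAction.source (Γ.arrow g b ⟨c, hbc⟩) =
      PartialAction.range (Γ.arrow h a ⟨b, hab⟩) := (Γ.ext_eq (Γ.rel_of hab)).symm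
  rw [← Φ.cocycle_mul _ _ hcomp]
  rfl

/-- The orbit cocycle of an isomorphism of transformation groupoids. -/
def Globalization.orbitCocycle (Γ : Globalization σ G M)
    (hfi : ∀ s, Finite (A ⧸ LinearMap.range (σ.toEnd s)))
    {K : Type*} {Y : Type*} [Group K] [TopologicalSpace Y] {ρ : PartialAction K Y}
    (Φ : PartialAction.GroupoidIso Γ.partialAction ρ) : OrbitCocycle Γ K where
  trans a b := Φ.cocycle (Γ.arrow (SemidirectProduct.inl (Multiplicative.ofAdd (Γ.j a))) b
    ⟨a + b, Γ.affine_inl a b⟩)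
  lin := MonoidHom.mk' (fun g => Φ.cocycle (Γ.arrow (SemidirectProduct.inr g) 0
    ⟨0, by rw [Γ.affine_inr]; simp⟩)) fun g h => by
      simp only [map_mul]
      exact Γ.arrow_comp (c := 0) (b := 0) (by rw [Γ.affine_inr]; simp)
        (by rw [Γ.affine_inr]; simp) Φ
  trans_add a a' b := by
    have := Γ.arrow_comp (Γ.affine_inl a' b) (Γ.affine_inl a (a' + b)) Φ
    rw [← this]
    congr 2
    simp [← map_mul, ← ofAdd_add]
  eq_zero a b h := by
    have h1 := Φ.eq_one_of_cocycle h
    have h2 : (SemidirectProduct.inl (Multiplicative.ofAdd (Γ.j a)) : AffineGroup Γ.act) = 1 := h1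
    have h3 := congrArg (fun g : AffineGroup Γ.act => Multiplicative.toAdd g.left) h2
    simp only [SemidirectProduct.left_inl, toAdd_ofAdd, SemidirectProduct.one_left,
      toAdd_one] at h3
    exact Γ.j_injective (h3.trans (map_zero _).symm)
  periodic a := by
    obtain ⟨C, hC⟩ := Completion.exists_periodic hfi
      (fun x => Φ.cocycle ⟨(_, x), Γ.mem_dom_inl a x⟩) fun x => by
        filter_upwards [Φ.cocycle_eventually ⟨(_, x), Γ.mem_dom_inl a x⟩] with y hy
        exact hy _
    refine ⟨C.1, C.2, fun b b' h => ?_⟩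
    exact hC (Completion.of σ b) (Completion.of σ b') ((Submodule.Quotient.eq _).2 h)
  conj g := by
    have h0 : affine Γ.act (SemidirectProduct.inr g) (Γ.j 0) = Γ.j 0 := by
      rw [Γ.affine_inr]; simp
    obtain ⟨C, hC⟩ := Completion.exists_nhds
      (Φ.cocycle_eventually (Γ.arrow (SemidirectProduct.inr g) 0 ⟨0, h0⟩))
    refine ⟨C.1, C.2, fun a ha a' haa' => ?_⟩
    have hga : affine Γ.act (SemidirectProduct.inr g) (Γ.j a) = Γ.j a' := by
      rw [Γ.affine_inr, haa']
    -- The element `t_{g.a} g = g t_a` is factored at `0` in two ways. The second factorization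
    -- involves the cocycle of `g` at `a`, which equals that at `0` because `a` lies in the
    -- neighbourhood `C`.
    have h1 := Γ.arrow_comp h0 ((Γ.affine_inl a' 0).trans (by rw [add_zero])) Φ
    have h2 := Γ.arrow_comp ((Γ.affine_inl a 0).trans (by rw [add_zero])) hga Φ
    have h3 : Φ.cocycle (Γ.arrow (SemidirectProduct.inr g) a ⟨a', hga⟩) =
        Φ.cocycle (Γ.arrow (SemidirectProduct.inr g) 0 ⟨0, h0⟩) :=
      hC (Completion.of σ a) ((Submodule.Quotient.eq _).2 (by simpa using ha)) _
    rw [h3] at h2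
    refine h1.symm.trans (Eq.trans ?_ h2)
    congr 2
    refine SemidirectProduct.ext ?_ ?_
    · simp only [SemidirectProduct.mul_left, SemidirectProduct.left_inl,
        SemidirectProduct.right_inl, SemidirectProduct.left_inr, SemidirectProduct.right_inr,
        map_one, mul_one, one_mul]
      exact congrArg Multiplicative.ofAdd haa'.symm
    · simp

end OrbitCocycle

/-! ### Commutation in two-generated free groups -/

section FreeGroup

/-- An element commuting with the free generators is central. This applies to the only generator,
and then to every element. -/
theorem commute_of_subsingleton_generators {F : Type*} [Group F] [IsFreeGroup F]
    [Subsingleton (IsFreeGroup.Generators F)] (g y : F) : Commute g y := by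
  have key : ∀ z : F, (∀ x, z * IsFreeGroup.of x * z⁻¹ = IsFreeGroup.of x) →
      ∀ w, z * w * z⁻¹ = w := by
    intro z hz w
    have : (MulAut.conj z).toMonoidHom = MonoidHom.id F := IsFreeGroup.ext_hom fun x => by
      simpa using hz x
    simpa using DFunLike.congr_fun this w
  have h := key g (fun x => by
    have hx := key (IsFreeGroup.of x) (fun x' => by rw [Subsingleton.elim x' x]; group) g
    rw [mul_inv_eq_iff_eq_mul] at hx ⊢
    exact hx.symm) y
  rwa [mul_inv_eq_iff_eq_mul] at h

/-- In a free group generated by `g` and `y`, if `y` commutes with `g y g⁻¹`, then `y` commutes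
with `g`. -/
theorem commute_of_commute_conj {F : Type*} [Group F] (hF : IsFreeGroup F) {g y : F}
    (hgen : Subgroup.closure {g, y} = ⊤) (hc : Commute y (g * y * g⁻¹)) : Commute g y := by
  classical
  rcases subsingleton_or_nontrivial (IsFreeGroup.Generators F) with hX | hX
  · exact commute_of_subsingleton_generators g y
  exfalso
  obtain ⟨x₁, x₂, hx⟩ := exists_pair_ne (IsFreeGroup.Generators F)
  -- Count homomorphisms to `S₃`: two distinct free generators give at least `|K|²` of them, and two
  -- generators `g`, `y` allow at most `|K|²`. Hence every pair of values for `(g, y)` occurs.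
  let K := Equiv.Perm (Fin 3)
  let φ : K × K → F →* K := fun k =>
    IsFreeGroup.lift fun x => if x = x₁ then k.1 else k.2
  let e : (F →* K) → K × K := fun f => (f g, f y)
  have hφ : Function.Injective φ := by
    intro k k' h
    have h1 := DFunLike.congr_fun h (IsFreeGroup.of x₁)
    have h2 := DFunLike.congr_fun h (IsFreeGroup.of x₂)
    simp only [φ, IsFreeGroup.lift_of, if_true, if_neg hx.symm] at h1 h2
    exact Prod.ext h1 h2
  have he : Function.Injective e := by
    intro f f' h
    refine MonoidHom.eq_of_eqOn_dense hgen ?_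
    rintro z (rfl | rfl)
    · exact congrArg Prod.fst h
    · exact congrArg Prod.snd h
  obtain ⟨k, hk⟩ := Finite.surjective_of_injective (he.comp hφ)
    (Equiv.swap (0 : Fin 3) 1, Equiv.swap (0 : Fin 3) 2)
  have h1 : φ k g = Equiv.swap (0 : Fin 3) 1 := congrArg Prod.fst hk
  have h2 : φ k y = Equiv.swap (0 : Fin 3) 2 := congrArg Prod.snd hk
  have := hc.map (φ k)
  simp only [map_mul, map_inv, h1, h2] at this
  -- The conjugate of `(0 2)` by `(0 1)` is `(1 2)`, which does not commute with `(0 2)`.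
  revert this
  simp only [Commute, SemiconjBy]
  decide

theorem TwoGenFreeOrAbelian.commute {H : Type*} [Group H] (hH : TwoGenFreeOrAbelian H) {g y : H}
    (hc : Commute y (g * y * g⁻¹)) : Commute g y := by
  set P := Subgroup.closure ({g, y} : Set H) with hP
  have hg : g ∈ P := Subgroup.subset_closure (by simp)
  have hy : y ∈ P := Subgroup.subset_closure (by simp)
  have key : Commute (⟨g, hg⟩ : P) ⟨y, hy⟩ := by
    rcases hH g y with h | h
    · refine commute_of_commute_conj h ?_ (Subtype.ext hc)
      rw [← Subgroup.closure_closure_coe_preimage (k := ({g, y} : Set H))]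
      congr 1
      ext z
      simp [Subtype.ext_iff]
    · exact h _ _
  exact congrArg Subtype.val key

end FreeGroup

/-! ### Linear maps conjugate to a proper power -/

section LinearAlgebra

/-- An automorphism of a finite-dimensional space which is conjugate to its `k`-th power, `k ≥ 2`,
has a root of unity as an eigenvalue. -/
theorem exists_pow_fixed_of_conj_pow {V : Type*} [AddCommGroup V] [Module ℚ V]
    [Module.Finite ℚ V] [Nontrivial V] (f g : V ≃ₗ[ℚ] V) {k : ℕ} (hk : 2 ≤ k)
    (h : f ^ k = g * f * g⁻¹) : ∃ N : ℕ, 0 < N ∧ ∃ v : V, v ≠ 0 ∧ (f ^ N) v = v := by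
  let D := Module.End.baseChangeHom ℚ ℂ V
  let Φ : (V ≃ₗ[ℚ] V) →* (Module.End ℂ (ℂ ⊗[ℚ] V))ˣ :=
    (Units.map D.toRingHom.toMonoidHom).comp
      (LinearMap.GeneralLinearGroup.generalLinearEquiv ℚ V).symm.toMonoidHom
  have hΦ : ∀ u : V ≃ₗ[ℚ] V, (Φ u : Module.End ℂ (ℂ ⊗[ℚ] V)) = D (u : V →ₗ[ℚ] V) := fun u => rfl
  set F : Module.End ℂ (ℂ ⊗[ℚ] V) := (Φ f : (Module.End ℂ (ℂ ⊗[ℚ] V))ˣ).val with hF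
  have hconj : F ^ k = Φ g * F * ↑(Φ g)⁻¹ := by
    rw [hF, ← Units.val_pow_eq_pow_val, ← map_pow, h, map_mul, map_mul, map_inv]
    simp
  have hne : (spectrum ℂ F).Nonempty := spectrum.nonempty_of_isAlgClosed_of_finiteDimensional ℂ F
  -- Since `F ^ k` is conjugate to `F`, the finite spectrum is stable under `l ↦ l ^ k`; a
  -- repetition along an orbit makes the nonzero `l` a root of unity.
  have hmaps : ∀ l ∈ spectrum ℂ F, l ^ k ∈ spectrum ℂ F := by
    intro l hl
    have := spectrum.pow_mem_pow F k hl
    rwa [hconj, spectrum.units_conjugate] at this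
  have hiter : ∀ l ∈ spectrum ℂ F, ∀ m : ℕ, l ^ k ^ m ∈ spectrum ℂ F := by
    intro l hl m
    induction m with
    | zero => simpa using hl
    | succ m ih => rw [pow_succ, pow_mul]; exact hmaps _ ih
  obtain ⟨l, hl⟩ := hne
  have hfin : (spectrum ℂ F).Finite := Module.End.finite_spectrum F
  have := hfin.to_subtype
  obtain ⟨m, m', hmm, heq⟩ := Finite.exists_ne_map_eq_of_infinite
    fun m : ℕ => (⟨l ^ k ^ m, hiter l hl m⟩ : spectrum ℂ F)
  replace heq : l ^ k ^ m = l ^ k ^ m' := congrArg Subtype.val heq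
  have hl0 : l ≠ 0 := by
    rintro rfl
    exact spectrum.zero_notMem ℂ (Φ f).isUnit hl
  wlog hlt : m < m' generalizing m m'
  · exact this m' m hmm.symm heq.symm (lt_of_le_of_ne (not_lt.1 hlt) hmm.symm)
  have hpow : k ^ m < k ^ m' := Nat.pow_lt_pow_right hk hlt
  refine ⟨k ^ m' - k ^ m, Nat.sub_pos_of_lt hpow, ?_⟩
  set N := k ^ m' - k ^ m
  have hlN : l ^ N = 1 := by
    have h1 : l ^ k ^ m' = l ^ k ^ m * l ^ N := by rw [← pow_add, Nat.add_sub_cancel' hpow.le]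
    rw [← heq] at h1
    exact (mul_eq_left₀ (pow_ne_zero _ hl0)).1 h1.symm
  have h1 : (1 : ℂ) ∈ spectrum ℂ (F ^ N) := hlN ▸ spectrum.pow_mem_pow F N hl
  -- Descent to `ℚ`: if `f ^ N` had no nonzero fixed vector, `1 - f ^ N` would be invertible over
  -- `ℚ` and hence over `ℂ`.
  by_contra hcon
  push Not at hcon
  have hinj : Function.Injective ((1 : Module.End ℚ V) - (f ^ N : V ≃ₗ[ℚ] V).toLinearMap) := by
    rw [← LinearMap.ker_eq_bot, LinearMap.ker_eq_bot']
    intro v hv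
    by_contra hv0
    exact hcon v hv0 (sub_eq_zero.1 hv).symm
  have hu : IsUnit ((1 : Module.End ℚ V) - (f ^ N : V ≃ₗ[ℚ] V).toLinearMap) :=
    (LinearMap.isUnit_iff_ker_eq_bot _).2 (LinearMap.ker_eq_bot.2 hinj)
  have hu' := hu.map D
  rw [map_sub, map_one, ← hΦ, map_pow, Units.val_pow_eq_pow_val, ← hF] at hu'
  refine h1 ?_
  rw [spectrum.mem_resolventSet_iff, map_one]
  exact hu'

end LinearAlgebra

/-! ### Rationalization of torsion-free groups -/

section Rational

variable {M N : Type*} [AddCommGroup M] [AddCommGroup N]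

/-- Torsion-free abelian groups are flat, so tensoring keeps `ℤ → ℚ` injective. -/
theorem tmul_one_injective [IsAddTorsionFree M] :
    Function.Injective fun x : M => (1 : ℚ) ⊗ₜ[ℤ] x := by
  have : Module.IsTorsionFree ℤ M := inferInstance
  have hflat : Module.Flat ℤ M := inferInstance
  have h := Module.Flat.rTensor_preserves_injective_linearMap (M := M)
    (Algebra.linearMap ℤ ℚ) (algebraMap ℤ ℚ).injective_int
  intro x y hxy
  have : (1 : ℤ) ⊗ₜ[ℤ] x = (1 : ℤ) ⊗ₜ[ℤ] y := h (by simpa using hxy)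
  simpa using congrArg (TensorProduct.lid ℤ M) this

theorem exists_nsmul_eq_tmul (x : ℚ ⊗[ℤ] M) :
    ∃ n : ℕ, 0 < n ∧ ∃ m : M, (n : ℚ) • x = 1 ⊗ₜ[ℤ] m := by
  induction x using TensorProduct.induction_on with
  | zero => exact ⟨1, one_pos, 0, by simp⟩
  | tmul q m =>
    refine ⟨q.den, q.den_pos, q.num • m, ?_⟩
    rw [TensorProduct.smul_tmul', smul_eq_mul, mul_comm, Rat.mul_den_eq_num,
      ← TensorProduct.smul_tmul]
    simp
  | add x y hx hy =>
    obtain ⟨n, hn, m, hm⟩ := hx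
    obtain ⟨n', hn', m', hm'⟩ := hy
    refine ⟨n * n', mul_pos hn hn', n' • m + n • m', ?_⟩
    rw [TensorProduct.tmul_add, TensorProduct.tmul_smul, TensorProduct.tmul_smul, ← hm, ← hm',
      ← Nat.cast_smul_eq_nsmul ℚ, ← Nat.cast_smul_eq_nsmul ℚ, smul_smul, smul_smul, smul_add,
      Nat.cast_mul]
    rw [mul_comm (n' : ℚ) n]

/-- The `ℚ`-linear extension of an injective homomorphism into a rational vector space. -/
theorem liftBaseChange_injective {V : Type*} [AddCommGroup V] [Module ℚ V] (f : M →ₗ[ℤ] V)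
    (hf : Function.Injective f) : Function.Injective (f.liftBaseChange ℚ) := by
  rw [injective_iff_map_eq_zero]
  intro x hx
  obtain ⟨n, hn, m, hm⟩ := exists_nsmul_eq_tmul x
  have h1 : f.liftBaseChange ℚ ((n : ℚ) • x) = 0 := by rw [map_smul, hx, smul_zero]
  rw [hm, LinearMap.liftBaseChange_tmul, one_smul] at h1
  have hm0 : m = 0 := hf (h1.trans (map_zero f).symm)
  rw [hm0, TensorProduct.tmul_zero] at hm
  exact (smul_eq_zero.1 hm).resolve_left (by exact_mod_cast hn.ne')

end Rational

/-! ### Finite index of injective endomorphisms in finite rank -/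

section FiniteIndex

variable {M : Type*} [AddCommGroup M] [IsAddTorsionFree M]

theorem finrank_le_of_finiteRank (hM : FiniteRank M) {r : ℕ} {b : Fin r → M}
    (hb : LinearIndependent ℤ b) : r ≤ Module.finrank ℚ (ℚ ⊗[ℤ] M) := by
  have : Module.Finite ℚ (ℚ ⊗[ℤ] M) := hM
  have h1 : LinearIndependent ℤ (fun i => (1 : ℚ) ⊗ₜ[ℤ] b i) := by
    refine hb.map' (TensorProduct.mk ℤ ℚ M 1) (LinearMap.ker_eq_bot.2 ?_)
    exact tmul_one_injective
  have h2 := (LinearIndependent.iff_fractionRing ℤ ℚ).1 h1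
  simpa using h2.fintype_card_le_finrank

/-- For a torsion-free group `M` of finite rank, the quotients `M / dM` are finite. -/
theorem finite_quotient_smul (hM : FiniteRank M) {d : ℕ} (hd : 0 < d) :
    Finite (M ⧸ LinearMap.range (LinearMap.lsmul ℤ M (d : ℤ))) := by
  set D := LinearMap.range (LinearMap.lsmul ℤ M (d : ℤ)) with hD
  set n := Module.finrank ℚ (ℚ ⊗[ℤ] M)
  by_contra hinf
  have := not_finite_iff_infinite.1 hinf
  -- Lifts of these classes span a free group of rank `r ≤ n`, which meets at most `d ^ r` classes
  -- modulo `d`.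
  obtain ⟨s, hs⟩ := Infinite.exists_subset_card_eq (M ⧸ D) (d ^ n + 1)
  choose l hl using fun x : M ⧸ D => Submodule.Quotient.mk_surjective D x
  set F : Submodule ℤ M := Submodule.span ℤ (l '' (s : Set (M ⧸ D))) with hF
  have hfg : Module.Finite ℤ F :=
    Module.Finite.iff_fg.2 (Submodule.fg_span (s.finite_toSet.image l))
  have : Module.Free ℤ F := inferInstance
  let b := Module.finBasis ℤ F
  set r := Module.finrank ℤ F
  have hr : r ≤ n := finrank_le_of_finiteRank hM
    (b.linearIndependent.map' F.subtype F.ker_subtype)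
  let q : (Fin r → Fin d) → M ⧸ D := fun c => D.mkQ (∑ i, ((c i : ℕ) : ℤ) • (b i : M))
  have hsub : (s : Set (M ⧸ D)) ⊆ Set.range q := by
    intro x hx
    have hlx : l x ∈ F := Submodule.subset_span ⟨x, hx, rfl⟩
    have hdz : (0 : ℤ) < d := by exact_mod_cast hd
    let c : Fin r → ℤ := fun i => b.repr ⟨l x, hlx⟩ i
    refine ⟨fun i => ⟨(c i % d).toNat, ?_⟩, ?_⟩
    · have := Int.emod_lt_of_pos (c i) hdz
      have := Int.emod_nonneg (c i) hdz.ne'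
      omega
    · refine Eq.trans ?_ (hl x)
      change D.mkQ _ = D.mkQ _
      have hsum : l x = ∑ i, c i • (b i : M) := by
        have := congrArg F.subtype (b.sum_repr ⟨l x, hlx⟩)
        rw [map_sum] at this
        exact this.symm
      rw [← sub_eq_zero, ← map_sub, Submodule.mkQ_apply, Submodule.Quotient.mk_eq_zero, hsum,
        ← Finset.sum_sub_distrib]
      refine Submodule.sum_mem _ fun i _ => ⟨-(c i / d) • (b i : M), ?_⟩
      have hnn := Int.emod_nonneg (c i) hdz.ne'
      simp only [LinearMap.lsmul_apply]
      rw [Int.toNat_of_nonneg hnn, ← sub_smul, smul_smul]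
      congr 1
      have := Int.emod_add_mul_ediv (c i) d
      linarith
  have hcard : s.card ≤ d ^ r := by
    have h1 := Set.ncard_le_ncard hsub (Set.finite_range q)
    rw [Set.ncard_coe_finset] at h1
    have h2 : (Set.range q).ncard ≤ Nat.card (Fin r → Fin d) := by
      rw [← Nat.card_coe_set_eq]
      exact Finite.card_range_le q
    simpa using h1.trans h2
  have := Nat.pow_le_pow_right hd hr
  omega

/-- An injective endomorphism of a torsion-free abelian group of finite rank has a range of finite
index. -/
theorem finiteIndex_range_of_injective (hM : FiniteRank M) (φ : M →+ M)
    (hφ : Function.Injective φ) : φ.range.FiniteIndex := by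
  have hfin : Module.Finite ℚ (ℚ ⊗[ℤ] M) := hM
  let f : Module.End ℤ M := φ.toIntLinearMap
  let D := Module.End.baseChangeHom ℤ ℚ M
  have hDinj : ∀ g : Module.End ℤ M, D g = 0 → g = 0 := by
    intro g hg
    ext x
    apply tmul_one_injective
    have := LinearMap.congr_fun hg ((1 : ℚ) ⊗ₜ[ℤ] x)
    exact this.trans (TensorProduct.tmul_zero _ _).symm
  have hFinj : Function.Injective (D f) :=
    Module.Flat.lTensor_preserves_injective_linearMap (M := ℚ) f hφ
  set p := (D f).charpoly with hp
  have hp0 : p.coeff 0 ≠ 0 := by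
    have h1 : (D f).det ≠ 0 := by
      have := (LinearMap.isUnit_iff_ker_eq_bot (D f)).2 (LinearMap.ker_eq_bot.2 hFinj)
      exact (this.map LinearMap.det).ne_zero
    rw [LinearMap.det_eq_sign_charpoly_coeff] at h1
    exact right_ne_zero_of_mul h1
  -- Clearing denominators in Cayley–Hamilton gives an integral `q` with `q(f) = 0` and `q(0) ≠ 0`,
  -- so `q(0) M` lies in the range of `f` and has finite index.
  obtain ⟨c, hcm, hc⟩ := IsLocalization.integerNormalization_spec (nonZeroDivisors ℤ) p
  set q := IsLocalization.integerNormalization (nonZeroDivisors ℤ) p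
  have hq0 : q.coeff 0 ≠ 0 := by
    intro h
    have h2 := congrArg (fun r => Polynomial.coeff r 0) hc
    simp only [Polynomial.coeff_map, h, map_zero] at h2
    have hc0 : c ≠ 0 := nonZeroDivisors.ne_zero hcm
    rw [Polynomial.coeff_smul] at h2
    exact (smul_ne_zero hc0 hp0) h2.symm
  have hqf : Polynomial.aeval f q = 0 := by
    apply hDinj
    rw [← Polynomial.aeval_algHom_apply D f q, ← Polynomial.aeval_map_algebraMap ℚ, hc, map_zsmul,
      LinearMap.aeval_self_charpoly, smul_zero]
  have hrange : ∀ x : M, q.coeff 0 • x ∈ φ.range := by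
    intro x
    have h1 := LinearMap.congr_fun hqf x
    rw [← Polynomial.X_mul_divX_add q, map_add, map_mul, Polynomial.aeval_X,
      Polynomial.aeval_C] at h1
    simp only [LinearMap.add_apply, Module.End.mul_apply, Module.algebraMap_end_apply,
      LinearMap.zero_apply] at h1
    rw [eq_neg_of_add_eq_zero_right h1]
    exact neg_mem ⟨_, rfl⟩
  have hfq := finite_quotient_smul hM (Int.natAbs_pos.2 hq0)
  have h2 : (LinearMap.range (LinearMap.lsmul ℤ M
      ((q.coeff 0).natAbs : ℤ))).toAddSubgroup.FiniteIndex :=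
    AddSubgroup.finiteIndex_iff_finite_quotient.2 hfq
  refine AddSubgroup.finiteIndex_of_le (H := (LinearMap.range (LinearMap.lsmul ℤ M
      ((q.coeff 0).natAbs : ℤ))).toAddSubgroup) ?_
  rintro _ ⟨x, rfl⟩
  rw [LinearMap.lsmul_apply]
  rcases Int.natAbs_eq (q.coeff 0) with h | h
  · rw [← h]; exact hrange x
  · rw [← neg_eq_iff_eq_neg.2 h, neg_smul]; exact neg_mem (hrange x)

end FiniteIndex

/-! ### Conjugation and torsion in the affine group -/

section AffineGroup

variable {H N : Type*} [Group H] [AddCommGroup N] {β : H →* (N ≃ₗ[ℤ] N)}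

theorem affineGroup_conj_inl (g : AffineGroup β) (z : N) :
    g * SemidirectProduct.inl (Multiplicative.ofAdd z) * g⁻¹ =
      SemidirectProduct.inl (Multiplicative.ofAdd (β g.right z)) := by
  rw [mul_inv_eq_iff_eq_mul]
  refine SemidirectProduct.ext ?_ ?_
  · simp only [SemidirectProduct.mul_left, SemidirectProduct.left_inl,
      SemidirectProduct.right_inl, map_one, MulAut.one_apply]
    rw [mul_comm]
    rfl
  · simp

theorem affineGroup_eq_inl {p : AffineGroup β} (hp : p.right = 1) :
    p = SemidirectProduct.inl p.left :=
  SemidirectProduct.ext (by simp) (by simp [hp])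

/-- If `β` satisfies (F), then elements of `N ⋊ H` which have a torsion component in `H` are
translations or torsion. -/
theorem CondF.right_eq_one_or (hF : CondF β) {p : AffineGroup β} (hp : IsOfFinOrder p.right) :
    p.right = 1 ∨ IsOfFinOrder p := by
  by_cases h1 : p.right = 1
  · exact Or.inl h1
  right
  obtain ⟨l, hl, hl1⟩ := isOfFinOrder_iff_pow_eq_one.1 hp
  have hr : (p ^ l).right = 1 := by
    rw [← hl1]
    exact map_pow SemidirectProduct.rightHom p l
  have hinl := affineGroup_eq_inl hr
  set w := Multiplicative.toAdd (p ^ l).left with hw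
  have hinl' : p ^ l = SemidirectProduct.inl (Multiplicative.ofAdd w) := hinl
  -- The translation `p ^ l` commutes with `p`, so its vector `w` is fixed by `p.right ≠ 1`, and (F)
  -- gives `w = 0`.
  have hconj := affineGroup_conj_inl p w
  rw [← hinl', ← pow_succ', pow_succ, mul_inv_cancel_right, hinl'] at hconj
  have hfix : w = β p.right w :=
    Multiplicative.ofAdd.injective (SemidirectProduct.inl_injective hconj)
  have hw0 : w = 0 := hF _ h1 (by simp [← hfix])
  refine isOfFinOrder_iff_pow_eq_one.2 ⟨l, hl, ?_⟩
  rw [hinl', hw0]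
  simp

end AffineGroup

/-! ### Finitely many conditions on small subgroups -/

section Constructible

variable {S A : Type*} [Monoid S] [AddCommGroup A] {σ : AlgebraicAction S A}

theorem Constructible.exists_forall_finset {ι : Type*} (t : Finset ι)
    (p : ι → Submodule ℤ A → Prop) (hp : ∀ i C D, D ≤ C → p i C → p i D)
    (h : ∀ i ∈ t, ∃ C, Constructible σ C ∧ p i C) : ∃ C, Constructible σ C ∧ ∀ i ∈ t, p i C := by
  classical
  induction t using Finset.induction_on with
  | empty => exact ⟨⊤, .top, by simp⟩
  | insert i t _ ih =>
    obtain ⟨C, hC, h1⟩ := ih fun j hj => h j (Finset.mem_insert_of_mem hj)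
    obtain ⟨D, hD, h2⟩ := h i (Finset.mem_insert_self i t)
    refine ⟨C ⊓ D, hC.inf hD, fun j hj => ?_⟩
    rcases Finset.mem_insert.1 hj with rfl | hj
    · exact hp _ _ _ inf_le_right h2
    · exact hp _ _ _ inf_le_left (h1 j hj)

theorem Exhausts.exists_le {P : ℕ → Submodule ℤ A} (hP : Exhausts P) {Q : Submodule ℤ A}
    (hQ : Q.FG) : ∃ n, Q ≤ P n := by
  obtain ⟨t, rfl⟩ := hQ
  choose n hn using hP.2
  exact ⟨t.sup n, Submodule.span_le.2 fun x hx => hP.1 (Finset.le_sup hx) (hn x)⟩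

end Constructible

/-! ### Consequences of (FI) and (JF) -/

section Standing

variable {S A G M : Type*} [Monoid S] [AddCommGroup A] [Group G] [AddCommGroup M]
  {σ : AlgebraicAction S A} {Γ : Globalization σ G M}

/-- This is (JF) for the constructible subgroup `A` itself. -/
theorem Standing.act_injective (hΓ : Standing Γ) : Function.Injective Γ.act := by
  rw [injective_iff_map_eq_one]
  intro g hg
  exact hΓ.jf ⊤ .top g (by rw [Γ.generates]; trivial) fun x _ => by simp [hg]

/-- Each `g` maps some constructible subgroup into `A`, and by (FI) that subgroup contains a
multiple of every element of `A`. -/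
theorem Globalization.exists_nsmul_eq (Γ : Globalization σ G M)
    (hfi : ∀ s, Finite (A ⧸ LinearMap.range (σ.toEnd s))) (x : M) :
    ∃ n : ℕ, 0 < n ∧ ∃ a, n • x = Γ.j a := by
  have hx : x ∈ Submodule.span ℤ {x : M | ∃ g a, x = Γ.act g (Γ.j a)} := by
    rw [Γ.span_eq_top]; trivial
  induction hx using Submodule.span_induction with
  | mem x hx =>
    obtain ⟨g, a, rfl⟩ := hx
    obtain ⟨E, hE, h⟩ := Γ.exists_small g ⊤ .top
    obtain ⟨n, hn, hnE⟩ := hE.exists_nsmul_mem hfi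
    obtain ⟨b, -, hb⟩ := h _ (hnE a)
    exact ⟨n, hn, b, by rw [← hb, map_nsmul, map_nsmul]⟩
  | zero => exact ⟨1, one_pos, 0, by simp⟩
  | add x y _ _ hx hy =>
    obtain ⟨n, hn, a, ha⟩ := hx
    obtain ⟨m, hm, b, hb⟩ := hy
    refine ⟨n * m, mul_pos hn hm, m • a + n • b, ?_⟩
    rw [map_add, map_nsmul, map_nsmul, ← ha, ← hb, smul_add, smul_smul, smul_smul, mul_comm m n]
  | smul z x _ hx =>
    obtain ⟨n, hn, a, ha⟩ := hx
    exact ⟨n, hn, z • a, by rw [map_zsmul, ← ha, smul_comm]⟩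

theorem Globalization.isAddTorsionFree (Γ : Globalization σ G M) [IsAddTorsionFree M] :
    IsAddTorsionFree A :=
  Function.Injective.isAddTorsionFree Γ.j.toAddMonoidHom Γ.j_injective

end Standing

namespace OrbitCocycle

variable {S A G M H N : Type*} [Monoid S] [AddCommGroup A] [Group G] [AddCommGroup M]
  [Group H] [AddCommGroup N] {σ : AlgebraicAction S A} {Γ : Globalization σ G M}

/-! ### The homomorphism on small translations -/

section General

variable {K : Type*} [Group K] (c : OrbitCocycle Γ K)

theorem trans_zero (b : A) : c.trans 0 b = 1 := by
  have := c.trans_add 0 0 b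
  rw [add_zero, zero_add] at this
  exact left_eq_mul.1 this

/-- The translations whose cocycle is `C`-periodic. -/
def per (C : Submodule ℤ A) : Submodule ℤ A :=
  AddSubgroup.toIntSubmodule
    { carrier := {a | ∀ b b', b - b' ∈ C → c.trans a b = c.trans a b'}
      zero_mem' := fun b b' _ => by rw [c.trans_zero, c.trans_zero]
      add_mem' := fun {a a'} ha ha' b b' h => by
        rw [c.trans_add, c.trans_add, ha' b b' h, ha (a' + b) (a' + b') (by simpa using h)]
      neg_mem' := fun {a} ha b b' h => by
        have key : ∀ b, c.trans (-a) b = (c.trans a (-a + b))⁻¹ := fun b => by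
          rw [eq_inv_iff_mul_eq_one, mul_eq_one_comm, ← c.trans_add, add_neg_cancel,
            c.trans_zero]
        rw [key, key, ha (-a + b) (-a + b') (by simpa using h)] }

theorem per_anti {C D : Submodule ℤ A} (h : C ≤ D) : c.per D ≤ c.per C :=
  fun _ ha b b' hb => ha b b' (h hb)

/-- The subgroup of `C` on which `a ↦ c.trans a 0` is a homomorphism. -/
def stab (C : Submodule ℤ A) : Submodule ℤ A := c.per C ⊓ C

/-- The cocycle identity evaluates `trans a` at `b`; periodicity moves that base point back to `0`.
-/
theorem trans_add_zero {C : Submodule ℤ A} {a b : A} (ha : a ∈ c.per C) (hb : b ∈ C) :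
    c.trans (a + b) 0 = c.trans a 0 * c.trans b 0 := by
  rw [c.trans_add, add_zero, ha b 0 (by simpa using hb)]

/-- The restriction of `a ↦ c.trans a 0` to `c.stab C`. -/
def hom (C : Submodule ℤ A) : Multiplicative (c.stab C) →* K :=
  MonoidHom.mk' (fun a => c.trans (Multiplicative.toAdd a).1 0) fun a b =>
    c.trans_add_zero (Multiplicative.toAdd a).2.1 (Multiplicative.toAdd b).2.2

theorem trans_zsmul {C : Submodule ℤ A} {a : A} (ha : a ∈ c.stab C) (z : ℤ) :
    c.trans (z • a) 0 = c.trans a 0 ^ z :=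
  map_zpow (c.hom C) (Multiplicative.ofAdd ⟨a, ha⟩) z

theorem trans_nsmul {C : Submodule ℤ A} {a : A} (ha : a ∈ c.stab C) (n : ℕ) :
    c.trans (n • a) 0 = c.trans a 0 ^ n :=
  map_pow (c.hom C) (Multiplicative.ofAdd ⟨a, ha⟩) n

theorem trans_commute {C : Submodule ℤ A} {a b : A} (ha : a ∈ c.stab C) (hb : b ∈ c.stab C) :
    Commute (c.trans a 0) (c.trans b 0) := by
  rw [Commute, SemiconjBy, ← c.trans_add_zero ha.1 hb.2, ← c.trans_add_zero hb.1 ha.2, add_comm]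

theorem exists_mem_per (a : A) : ∃ C, Constructible σ C ∧ a ∈ c.per C := c.periodic a

theorem exists_le_per {Q : Submodule ℤ A} (hQ : Q.FG) : ∃ C, Constructible σ C ∧ Q ≤ c.per C := by
  obtain ⟨t, rfl⟩ := hQ
  obtain ⟨C, hC, h⟩ := Constructible.exists_forall_finset t (fun a C => a ∈ c.per C)
    (fun a C D h ha => c.per_anti h ha) fun a _ => c.exists_mem_per a
  exact ⟨C, hC, Submodule.span_le.2 h⟩

/-- Suitable multiples of `b` and `g.b` are conjugated by `g`. -/
theorem exists_nsmul_conj (hfi : ∀ s, Finite (A ⧸ LinearMap.range (σ.toEnd s))) {g : G} {b b' : A}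
    (hb : Γ.act g (Γ.j b) = Γ.j b') : ∃ n : ℕ, 0 < n ∧ ∃ C, Constructible σ C ∧
      n • b ∈ c.stab C ∧ n • b' ∈ c.stab C ∧
      c.trans (n • b') 0 = c.lin g * c.trans (n • b) 0 * (c.lin g)⁻¹ := by
  obtain ⟨C₁, hC₁, h₁⟩ := c.exists_mem_per b
  obtain ⟨C₂, hC₂, h₂⟩ := c.exists_mem_per b'
  obtain ⟨C₃, hC₃, h₃⟩ := c.conj g
  have hC := (hC₁.inf hC₂).inf hC₃
  obtain ⟨n, hn, hnC⟩ := hC.exists_nsmul_mem hfi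
  refine ⟨n, hn, _, hC, ⟨?_, hnC b⟩, ⟨?_, hnC b'⟩, ?_⟩
  · exact Submodule.smul_of_tower_mem _ n
      (c.per_anti (inf_le_left.trans inf_le_left) h₁)
  · exact Submodule.smul_of_tower_mem _ n
      (c.per_anti (inf_le_left.trans inf_le_right) h₂)
  · rw [eq_mul_inv_iff_mul_eq]
    exact h₃ _ (hnC b).2 _ (by rw [map_nsmul, map_nsmul, hb, map_nsmul])

end General

/-! ### Torsion of the `H`-components, and the resulting rational map -/

section Affine

variable {β : H →* (N ≃ₗ[ℤ] N)} (c : OrbitCocycle Γ (AffineGroup β))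

/-- The components in `H` of the translations near `0` are torsion. -/
def TorsionTranslations : Prop :=
  ∀ C, Constructible σ C → ∀ a ∈ c.stab C, IsOfFinOrder (c.trans a 0).right

variable {c}

/-- Since `id - σ_s` has finite index image in `P k`, some multiple of `a` is `b - σ_s b`. The
`H`-components of suitable multiples of `b` and `σ_s b` commute and are conjugate by the image of
`s`; as they commute, the free-or-abelian condition makes that conjugation trivial. -/
theorem torsionTranslations_of_condI1 (hfi : ∀ s, Finite (A ⧸ LinearMap.range (σ.toEnd s)))
    [IsAddTorsionFree A] {P : ℕ → Submodule ℤ A} (hP : Exhausts P) (hfr : ∀ n, FiniteRank (P n))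
    (hI : ∀ n, CondI1 σ H (P n)) : c.TorsionTranslations := by
  intro C hC a ha
  obtain ⟨k, hk⟩ := hP.2 a
  obtain ⟨⟨s, hs, hinj⟩, hH⟩ := hI k
  have : IsAddTorsionFree (P k) :=
    Function.Injective.isAddTorsionFree (P k).subtype.toAddMonoidHom Subtype.val_injective
  let φ : P k →ₗ[ℤ] P k := LinearMap.id - (σ.toEnd s).restrict hs
  have hφ : Function.Injective φ := by
    rw [injective_iff_map_eq_zero]
    intro x hx
    exact Subtype.ext (hinj x x.2 (congrArg Subtype.val hx))
  have hfin := finiteIndex_range_of_injective (hfr k) φ.toAddMonoidHom hφ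
  obtain ⟨m, hm, -, ⟨b, hb⟩⟩ := AddSubgroup.exists_nsmul_mem_of_index_ne_zero
    hfin.index_ne_zero (⟨a, hk⟩ : P k)
  have hb' : m • a = b.1 - σ.toEnd s b.1 := (congrArg Subtype.val hb).symm
  obtain ⟨n, hn, D, hD, h1, h2, hconj⟩ := c.exists_nsmul_conj hfi (Γ.act_ι s b.1)
  set p := c.trans (n • b.1) 0
  set q := c.trans (n • σ.toEnd s b.1) 0
  have hpq : Commute p q := c.trans_commute h1 h2
  have hq : q.right = (c.lin (Γ.ι s)).right * p.right * (c.lin (Γ.ι s)).right⁻¹ := by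
    rw [hconj]; simp
  have hcomm : Commute (c.lin (Γ.ι s)).right p.right := by
    refine hH.commute ?_
    rw [← hq]
    exact hpq.map SemidirectProduct.rightHom
  have hqp : q.right = p.right := by
    rw [hq, hcomm.eq, mul_inv_cancel_right]
  have hsum : c.trans ((n * m) • a) 0 * q = p := by
    rw [mul_smul, hb', smul_sub, ← c.trans_add_zero (sub_mem h1 h2).1 h2.2, sub_add_cancel]
  have hone : (c.trans ((n * m) • a) 0).right = 1 := by
    have := congrArg (fun x : AffineGroup β => x.right) hsum
    simpa [hqp] using this
  rw [c.trans_nsmul ha] at hone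
  refine isOfFinOrder_iff_pow_eq_one.2 ⟨n * m, mul_pos hn hm, ?_⟩
  rw [← hone]
  exact (map_pow SemidirectProduct.rightHom _ _).symm

/-- If `σ_s = κ id`, some power of the component in `H` of a translation near `0` is conjugate to
its `κ`-th power. -/
theorem exists_zpow_conj (hfi : ∀ s, Finite (A ⧸ LinearMap.range (σ.toEnd s))) {s : S} {κ : ℤ}
    (hκ : ∀ x, σ.toEnd s x = κ • x) {C : Submodule ℤ A} {a : A}
    (ha : a ∈ c.stab C) : ∃ n : ℕ, 0 < n ∧ ((c.trans a 0).right ^ n) ^ κ =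
      (c.lin (Γ.ι s)).right * (c.trans a 0).right ^ n * (c.lin (Γ.ι s)).right⁻¹ := by
  obtain ⟨n, hn, D, hD, h1, h2, hconj⟩ := c.exists_nsmul_conj hfi (Γ.act_ι s a)
  refine ⟨n, hn, ?_⟩
  rw [hκ, smul_comm, c.trans_zsmul h1, c.trans_nsmul ha] at hconj
  have := congrArg SemidirectProduct.rightHom hconj
  simpa only [map_zpow, map_pow, map_mul, map_inv, SemidirectProduct.rightHom_eq_right] using this

theorem torsionTranslations_of_condI2 (hfi : ∀ s, Finite (A ⧸ LinearMap.range (σ.toEnd s)))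
    (hI : CondI2 σ H) : c.TorsionTranslations := by
  intro C hC a ha
  obtain ⟨s, κ, -, -, hκ, htor⟩ := hI
  obtain ⟨n, hn, h⟩ := exists_zpow_conj hfi hκ ha
  exact (htor _ (isConj_iff.2 ⟨_, h.symm⟩)).of_pow hn.ne'

theorem torsionTranslations_of_condIFor (hfi : ∀ s, Finite (A ⧸ LinearMap.range (σ.toEnd s)))
    [IsAddTorsionFree A] {P : ℕ → Submodule ℤ A} (hP : Exhausts P) (hfr : ∀ n, FiniteRank (P n))
    (hI : CondIFor σ H P) : c.TorsionTranslations := by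
  rcases hI with hI | hI
  · exact torsionTranslations_of_condI1 hfi hP hfr hI
  · exact torsionTranslations_of_condI2 hfi hI

/-- A power `t` of the component satisfies `t ^ κ = g t g⁻¹`. If `|κ| ≥ 2`, some `t ^ m` with `m >
0` fixes a nonzero vector of `ℚ ⊗ N`, and (F) gives `t ^ m = 1`. -/
theorem torsionTranslations_of_condIII (hΓ : Standing Γ) [IsAddTorsionFree N]
    (hβ : Function.Injective β) (hIII : CondIII σ β) : c.TorsionTranslations := by
  intro C hC a ha
  obtain ⟨⟨s, κ, hκ0, hκ1, hκ⟩, hfr, hF⟩ := hIII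
  obtain ⟨n, hn, h⟩ := exists_zpow_conj hΓ.finite_index hκ ha
  refine IsOfFinOrder.of_pow (n := n) ?_ hn.ne'
  set t := (c.trans a 0).right ^ n
  set g := (c.lin (Γ.ι s)).right with hg
  rcases subsingleton_or_nontrivial N with hN | hN
  · have : t = 1 := hβ (by ext x; exact Subsingleton.elim _ _)
    rw [this]
    exact IsOfFinOrder.one
  -- Here powers do not grow. Faithfulness gives `s ^ 2 = 1`, so `g ^ 2 = 1`. If `g ≠ 1`, then `x +
  -- g.x` is fixed by `g`, and (F) yields `g = -1` on `N`. So `g` commutes with `t` in either case,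
  -- and `t⁻¹ = t`.
  by_cases hκ2 : κ = -1
  · subst hκ2
    have hs : s * s = 1 := hΓ.faithful (by
      ext x
      simp [hκ])
    have hgg : g * g = 1 := by
      have : (c.lin (Γ.ι (s * s))).right = 1 := by simp [hs]
      simpa using this
    have hgt : g * t * g⁻¹ = t := by
      by_cases hg1 : g = 1
      · simp [hg1]
      have hneg : ∀ x, β g x = -x := by
        intro x
        have hggx : β g (β g x) = x := by
          rw [← LinearEquiv.mul_apply, ← map_mul, hgg, map_one]
          rfl
        have : x + β g x = 0 := hF g hg1 (by simp [hggx, add_comm])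
        exact eq_neg_of_add_eq_zero_right this
      rw [mul_inv_eq_iff_eq_mul]
      refine hβ ?_
      ext x
      simp [hneg]
    rw [hgt, zpow_neg_one] at h
    refine isOfFinOrder_iff_pow_eq_one.2 ⟨2, two_pos, ?_⟩
    rw [pow_two]
    nth_rewrite 1 [← h]
    exact inv_mul_cancel t
  -- Conjugating twice replaces `κ` by `κ ^ 2`, a natural exponent even when `κ` is negative.
  · have hk : 2 ≤ (κ * κ).natAbs := by
      rw [Int.natAbs_mul]
      have : 2 ≤ κ.natAbs := by omega
      nlinarith
    have hk' : (((κ * κ).natAbs : ℕ) : ℤ) = κ * κ := Int.natAbs_of_nonneg (mul_self_nonneg κ)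
    have hpow : t ^ (κ * κ).natAbs = (g * g) * t * (g * g)⁻¹ := by
      rw [← zpow_natCast, hk', zpow_mul, h, conj_zpow, h]
      group
    have hfin : Module.Finite ℚ (ℚ ⊗[ℤ] N) := hfr
    have hnt : Nontrivial (ℚ ⊗[ℤ] N) := (tmul_one_injective (M := N)).nontrivial
    obtain ⟨m, hm, v, hv, hfix⟩ := exists_pow_fixed_of_conj_pow (rat β t) (rat β (g * g)) hk (by
      rw [← map_pow, hpow, map_mul, map_mul, map_inv])
    obtain ⟨l, hl, x, hx⟩ := exists_nsmul_eq_tmul v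
    refine isOfFinOrder_iff_pow_eq_one.2 ⟨m, hm, ?_⟩
    by_contra hne
    have hx0 : x = 0 := by
      refine hF _ hne ?_
      have h1 : rat β (t ^ m) ((l : ℚ) • v) = (l : ℚ) • v := by rw [map_smul, map_pow, hfix]
      rw [hx] at h1
      have h2 : β (t ^ m) x = x := tmul_one_injective h1
      change x - β (t ^ m) x = 0 - β (t ^ m) 0
      rw [h2, map_zero, sub_self, sub_zero]
    rw [hx0, TensorProduct.tmul_zero] at hx
    exact hv ((smul_eq_zero.1 hx).resolve_left (by exact_mod_cast hl.ne'))

variable (c)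

/-- The graph of the rational map `M → ℚ ⊗ N` defined by the translations near `0`. -/
def Graph (x : M) (y : ℚ ⊗[ℤ] N) : Prop :=
  ∃ n : ℕ, 0 < n ∧ ∃ C, Constructible σ C ∧ ∃ a ∈ c.stab C, ∃ z : N,
    c.trans a 0 = SemidirectProduct.inl (Multiplicative.ofAdd z) ∧ n • x = Γ.j a ∧
      n • y = 1 ⊗ₜ[ℤ] z

variable {c}

theorem trans_nsmul_inl {C : Submodule ℤ A} {a : A} (ha : a ∈ c.stab C) {z : N}
    (hz : c.trans a 0 = SemidirectProduct.inl (Multiplicative.ofAdd z)) (n : ℕ) :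
    c.trans (n • a) 0 = SemidirectProduct.inl (Multiplicative.ofAdd (n • z)) := by
  rw [c.trans_nsmul ha, hz, ← map_pow, ofAdd_nsmul]

theorem graph_of_right_eq_one {C : Submodule ℤ A} (hC : Constructible σ C) {a : A}
    (ha : a ∈ c.stab C) (h1 : (c.trans a 0).right = 1) :
    c.Graph (Γ.j a) (1 ⊗ₜ[ℤ] Multiplicative.toAdd (c.trans a 0).left) :=
  ⟨1, one_pos, C, hC, a, ha, _, affineGroup_eq_inl h1, one_smul _ _, one_smul _ _⟩

theorem Graph.unique {x : M} {y y' : ℚ ⊗[ℤ] N} (h : c.Graph x y) (h' : c.Graph x y') : y = y' := by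
  obtain ⟨n, hn, C, hC, a, ha, z, hz, hx, hy⟩ := h
  obtain ⟨n', hn', C', hC', a', ha', z', hz', hx', hy'⟩ := h'
  -- Both sides represent `n n' x`; as `trans` at `0` does not depend on the choice of `C`, the two
  -- translation vectors can be compared.
  have haa : n' • a = n • a' := Γ.j_injective (by
    rw [map_nsmul, map_nsmul, ← hx, ← hx', smul_comm])
  have hzz : n' • z = n • z' := by
    have h1 := trans_nsmul_inl ha hz n'
    rw [haa, trans_nsmul_inl ha' hz' n] at h1
    exact (Multiplicative.ofAdd.injective (SemidirectProduct.inl_injective h1)).symm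
  have hyy : (n' * n) • y = (n' * n) • y' := by
    rw [mul_smul, hy, mul_comm, mul_smul, hy', ← TensorProduct.tmul_smul, hzz,
      TensorProduct.tmul_smul]
  rw [← Nat.cast_smul_eq_nsmul ℚ, ← Nat.cast_smul_eq_nsmul ℚ] at hyy
  have h0 : ((n' * n : ℕ) : ℚ) ≠ 0 := by exact_mod_cast (mul_pos hn' hn).ne'
  exact (smul_right_injective _ h0) hyy

/-- The factor `k` moves both representatives into the common subgroup `C ⊓ C'`, where `trans` is
additive. -/
theorem Graph.add (hfi : ∀ s, Finite (A ⧸ LinearMap.range (σ.toEnd s))) {x x' : M}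
    {y y' : ℚ ⊗[ℤ] N} (h : c.Graph x y) (h' : c.Graph x' y') : c.Graph (x + x') (y + y') := by
  obtain ⟨n, hn, C, hC, a, ha, z, hz, hx, hy⟩ := h
  obtain ⟨n', hn', C', hC', a', ha', z', hz', hx', hy'⟩ := h'
  obtain ⟨k, hk, hkD⟩ := (hC.inf hC').exists_nsmul_mem hfi
  have h1 : (k * n') • a ∈ c.stab (C ⊓ C') :=
    ⟨Submodule.smul_of_tower_mem _ _ (c.per_anti inf_le_left ha.1), mul_smul k n' a ▸ hkD _⟩
  have h2 : (k * n) • a' ∈ c.stab (C ⊓ C') :=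
    ⟨Submodule.smul_of_tower_mem _ _ (c.per_anti inf_le_right ha'.1), mul_smul k n a' ▸ hkD _⟩
  refine ⟨k * (n * n'), by positivity, _, hC.inf hC', _, add_mem h1 h2,
    (k * n') • z + (k * n) • z', ?_, ?_, ?_⟩
  · rw [c.trans_add_zero h1.1 h2.2, trans_nsmul_inl ha hz, trans_nsmul_inl ha' hz', ofAdd_add,
      map_mul]
  · rw [map_add, map_nsmul, map_nsmul, ← hx, ← hx', smul_smul, smul_smul, smul_add]
    congr 2 <;> ring
  · rw [TensorProduct.tmul_add, TensorProduct.tmul_smul, TensorProduct.tmul_smul, ← hy, ← hy',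
      smul_smul, smul_smul, smul_add]
    congr 2 <;> ring

/-- The factor `k` ensures that `g` maps `k • a` into `A`, and `l` that the conjugation formula
applies. Conjugating a translation by `lin g` only sees the `H`-component. -/
theorem Graph.act (hfi : ∀ s, Finite (A ⧸ LinearMap.range (σ.toEnd s))) {x : M}
    {y : ℚ ⊗[ℤ] N} (h : c.Graph x y) (g : G) :
    c.Graph (Γ.act g x) (rat β (c.lin g).right y) := by
  obtain ⟨n, hn, C, hC, a, ha, z, hz, hx, hy⟩ := h
  obtain ⟨E, hE, hs⟩ := Γ.exists_small g ⊤ .top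
  obtain ⟨k, hk, hkE⟩ := hE.exists_nsmul_mem hfi
  obtain ⟨b, -, hb⟩ := hs _ (hkE a)
  obtain ⟨l, hl, D, hD, h1, h2, hconj⟩ := c.exists_nsmul_conj hfi hb
  refine ⟨l * k * n, by positivity, D, hD, _, h2, β (c.lin g).right ((l * k) • z), ?_, ?_, ?_⟩
  · rw [hconj, smul_smul, trans_nsmul_inl ha hz, affineGroup_conj_inl]
  · rw [map_nsmul, ← hb, mul_smul, ← map_nsmul (Γ.act g) n, hx, map_nsmul Γ.j k, map_nsmul _ k,
      mul_smul]
  · rw [mul_smul, ← map_nsmul (rat β _) n, hy, map_nsmul, TensorProduct.tmul_smul]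
    rfl

/-- Three multiples are taken: `n` to reach `A`, `k` to reach `stab C`, `l` to kill the torsion
`H`-component. -/
theorem TorsionTranslations.exists_graph (hc : c.TorsionTranslations)
    (hfi : ∀ s, Finite (A ⧸ LinearMap.range (σ.toEnd s))) (x : M) : ∃ y, c.Graph x y := by
  obtain ⟨n, hn, a, ha⟩ := Γ.exists_nsmul_eq hfi x
  obtain ⟨C, hC, haC⟩ := c.exists_mem_per a
  obtain ⟨k, hk, hkC⟩ := hC.exists_nsmul_mem hfi
  have h1 : k • a ∈ c.stab C := ⟨Submodule.smul_of_tower_mem _ _ haC, hkC a⟩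
  obtain ⟨l, hl, hl1⟩ := isOfFinOrder_iff_pow_eq_one.1 (hc C hC _ h1)
  have hr : (c.trans (l • k • a) 0).right = 1 := by
    rw [c.trans_nsmul h1, ← hl1]
    exact map_pow SemidirectProduct.rightHom _ _
  set z := Multiplicative.toAdd (c.trans (l • k • a) 0).left with hz
  have hpos : 0 < l * k * n := by positivity
  refine ⟨((l * k * n : ℕ) : ℚ)⁻¹ • (1 ⊗ₜ[ℤ] z), l * k * n, hpos, C, hC,
    l • k • a, Submodule.smul_of_tower_mem _ _ h1, z, affineGroup_eq_inl hr, ?_, ?_⟩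
  · rw [mul_smul, ha, map_nsmul, map_nsmul, mul_smul]
  · rw [← Nat.cast_smul_eq_nsmul ℚ, smul_smul, mul_inv_cancel₀ (by exact_mod_cast hpos.ne'),
      one_smul]

/-- If the translations near `0` are torsion modulo `N`, they define an injective equivariant
homomorphism `M → ℚ ⊗ N`. -/
theorem TorsionTranslations.exists_hom (hc : c.TorsionTranslations)
    (hfi : ∀ s, Finite (A ⧸ LinearMap.range (σ.toEnd s))) [IsAddTorsionFree M]
    [IsAddTorsionFree N] : ∃ f : M →+ ℚ ⊗[ℤ] N, Function.Injective f ∧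
      (∀ g x, f (Γ.act g x) = rat β (c.lin g).right (f x)) ∧
      ∀ C, Constructible σ C → ∀ a ∈ c.stab C, (c.trans a 0).right = 1 →
        f (Γ.j a) = 1 ⊗ₜ[ℤ] Multiplicative.toAdd (c.trans a 0).left := by
  choose f hf using hc.exists_graph hfi
  refine ⟨AddMonoidHom.mk' f fun x x' => (hf _).unique ((hf x).add hfi (hf x')), ?_,
    fun g x => (hf _).unique ((hf x).act hfi g),
    fun C hC a ha h1 => (hf _).unique (graph_of_right_eq_one hC ha h1)⟩
  rw [injective_iff_map_eq_zero]
  intro x hx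
  obtain ⟨n, hn, C, hC, a, ha, z, hz, hxa, hy⟩ := hf x
  have hfx : f x = 0 := hx
  rw [hfx, smul_zero] at hy
  have hz0 : z = 0 := tmul_one_injective (hy.symm.trans (TensorProduct.tmul_zero _ _).symm)
  have ha0 : a = 0 := c.eq_zero a 0 (by rw [hz, hz0]; simp)
  rw [ha0, map_zero] at hxa
  exact (smul_eq_zero.1 hxa).resolve_left hn.ne'

/-- The homomorphism `G → H` given by the isotropy at `0`. -/
def grpHom (c : OrbitCocycle Γ (AffineGroup β)) : G →* H :=
  SemidirectProduct.rightHom.comp c.lin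

/-- An element in the kernel acts trivially on the image of `f`, hence on `M`. The action `r` is
arbitrary so that both `ℚ ⊗ N` and `N` are covered. -/
theorem grpHom_injective (hΓ : Standing Γ) {V : Type*} [AddCommGroup V] {f : M → V}
    {r : H → V → V} (hr : ∀ v, r 1 v = v)
    (hf : Function.Injective f) (heq : ∀ g x, f (Γ.act g x) = r (c.grpHom g) (f x)) :
    Function.Injective c.grpHom := by
  rw [injective_iff_map_eq_one]
  intro g hg
  refine hΓ.act_injective ?_
  ext x
  rw [map_one]
  exact hf (by rw [heq, hg, hr]; rfl)

theorem TorsionTranslations.nonempty_ratEmbedding (hc : c.TorsionTranslations) (hΓ : Standing Γ)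
    [IsAddTorsionFree M] [IsAddTorsionFree N] :
    Nonempty (ActionEmbedding (rat Γ.act) (rat β)) := by
  obtain ⟨f, hf, heq, -⟩ := hc.exists_hom hΓ.finite_index
  let F := f.toIntLinearMap.liftBaseChange ℚ
  refine ⟨⟨c.grpHom, ?_, F.toAddMonoidHom, liftBaseChange_injective f.toIntLinearMap hf, ?_⟩⟩
  · exact grpHom_injective (r := fun h v => rat β h v) hΓ (fun v => by simp) hf heq
  · intro g x
    have : F ∘ₗ (rat Γ.act g).toLinearMap = (rat β (c.grpHom g)).toLinearMap ∘ₗ F := by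
      apply TensorProduct.AlgebraTensorModule.curry_injective
      ext x
      change (1 : ℚ) • f (Γ.act g x) = rat β (c.lin g).right ((1 : ℚ) • f x)
      rw [one_smul, one_smul, heq]
    exact LinearMap.congr_fun this x

/-- Under (F) a nontrivial torsion component would make `trans a 0` itself torsion; the cocycle
detects zero and `A` is torsion-free, so `a = 0`. -/
theorem TorsionTranslations.right_eq_one_of_condF (hc : c.TorsionTranslations) (hF : CondF β)
    [IsAddTorsionFree A] {C : Submodule ℤ A} (hC : Constructible σ C) {a : A}
    (ha : a ∈ c.stab C) : (c.trans a 0).right = 1 := by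
  rcases hF.right_eq_one_or (hc C hC a ha) with h | h
  · exact h
  obtain ⟨l, hl, hl1⟩ := isOfFinOrder_iff_pow_eq_one.1 h
  rw [← c.trans_nsmul ha] at hl1
  have ha0 : a = 0 := (smul_eq_zero.1 (c.eq_zero _ _ hl1)).resolve_left hl.ne'
  rw [ha0, c.trans_zero]
  rfl

/-- The components of finitely many generators commute and are torsion, so the product of their
orders works. -/
theorem TorsionTranslations.exists_exponent (hc : c.TorsionTranslations) {C : Submodule ℤ A}
    (hC : Constructible σ C) {Q : Submodule ℤ A} (hQ : Q.FG) (hQC : Q ≤ c.stab C) :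
    ∃ n : ℕ, 0 < n ∧ ∀ a ∈ Q, (c.trans a 0).right ^ n = 1 := by
  obtain ⟨t, rfl⟩ := hQ
  have hsub : ∀ x ∈ t, x ∈ c.stab C := fun x hx => hQC (Submodule.subset_span hx)
  refine ⟨∏ x ∈ t, orderOf (c.trans x 0).right,
    Finset.prod_pos fun x hx => (hc C hC x (hsub x hx)).orderOf_pos, fun a ha => ?_⟩
  let π : Multiplicative (c.stab C) →* H := SemidirectProduct.rightHom.comp (c.hom C)
  induction ha using Submodule.span_induction with
  | mem x hx => exact orderOf_dvd_iff_pow_eq_one.1 (Finset.dvd_prod_of_mem _ hx)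
  | zero => rw [c.trans_zero]; exact one_pow _
  | add x y hx hy ihx ihy =>
    have hcomm := (c.trans_commute (hQC hx) (hQC hy)).map SemidirectProduct.rightHom
    rw [c.trans_add_zero (hQC hx).1 (hQC hy).2, SemidirectProduct.mul_right]
    have := hcomm.mul_pow (∏ x ∈ t, orderOf (c.trans x 0).right)
    simp only [SemidirectProduct.rightHom_eq_right] at this
    rw [this, ihx, ihy, one_mul]
  | smul z x hx ihx =>
    rw [c.trans_zsmul (hQC hx)]
    have h1 : (c.trans x 0 ^ z).right = (c.trans x 0).right ^ z :=
      map_zpow SemidirectProduct.rightHom _ _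
    rw [h1, ← zpow_natCast, zpow_comm, zpow_natCast, ihx, one_zpow]

end Affine

end OrbitCocycle

/-! ### The relation extracted from condition (ii₁) -/

section CharPoly

variable {S A : Type*} [Monoid S] [AddCommGroup A] {σ : AlgebraicAction S A}

/-- Cayley–Hamilton gives the relation on `ℚ ⊗ P`, and it descends because `P` is torsion-free. -/
theorem nsmul_pow_eq_nsmul_of_charpoly [IsAddTorsionFree A] {P : Submodule ℤ A}
    (hP : FiniteRank P) {s : S} (hs : ∀ x ∈ P, σ.toEnd s x ∈ P) {μ ν δ : ℕ}
    (h : Polynomial.C (μ : ℚ) * ratCharpoly hP ((σ.toEnd s).restrict hs)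
      = Polynomial.C (μ : ℚ) * Polynomial.X ^ δ - Polynomial.C (ν : ℚ)) {a : A} (ha : a ∈ P) :
    μ • σ.toEnd (s ^ δ) a = ν • a := by
  have hfin : Module.Finite ℚ (ℚ ⊗[ℤ] P) := hP
  have : IsAddTorsionFree P :=
    Function.Injective.isAddTorsionFree P.subtype.toAddMonoidHom Subtype.val_injective
  set f : Module.End ℤ P := (σ.toEnd s).restrict hs with hf
  have h1 := congrArg (Polynomial.aeval (LinearMap.baseChange ℚ f)) h
  have h0 : Polynomial.aeval (LinearMap.baseChange ℚ f) (ratCharpoly hP f) = 0 :=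
    LinearMap.aeval_self_charpoly _
  rw [map_mul, h0, mul_zero, map_sub, map_mul, Polynomial.aeval_C, map_pow, Polynomial.aeval_X,
    Polynomial.aeval_C] at h1
  have h2 := LinearMap.congr_fun (sub_eq_zero.1 h1.symm) (1 ⊗ₜ[ℤ] (⟨a, ha⟩ : P))
  have hpow : ∀ k : ℕ, (LinearMap.baseChange ℚ f ^ k) (1 ⊗ₜ[ℤ] (⟨a, ha⟩ : P))
      = 1 ⊗ₜ[ℤ] ((f ^ k) ⟨a, ha⟩) := by
    intro k
    induction k with
    | zero => simp
    | succ k ih =>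
      rw [pow_succ', pow_succ', Module.End.mul_apply, Module.End.mul_apply, ih,
        LinearMap.baseChange_tmul]
  have hval : ∀ k : ℕ, ((f ^ k) ⟨a, ha⟩ : A) = σ.toEnd (s ^ k) a := by
    intro k
    induction k with
    | zero => simp
    | succ k ih =>
      rw [pow_succ', pow_succ', map_mul, Module.End.mul_apply, Module.End.mul_apply, ← ih]
      rfl
  rw [Module.End.mul_apply, hpow, Module.algebraMap_end_apply, Module.algebraMap_end_apply,
    Nat.cast_smul_eq_nsmul ℚ, Nat.cast_smul_eq_nsmul ℚ, ← TensorProduct.tmul_smul,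
    ← TensorProduct.tmul_smul] at h2
  have h3 : μ • (f ^ δ) ⟨a, ha⟩ = ν • (⟨a, ha⟩ : P) := tmul_one_injective h2
  have h4 := congrArg Subtype.val h3
  rw [← hval]
  exact h4

end CharPoly

/-! ### From rational to integral embeddings -/

section Integral

variable {S A G M H N : Type*} [Monoid S] [AddCommGroup A] [Group G] [AddCommGroup M]
  [Group H] [AddCommGroup N]
  {σ : AlgebraicAction S A} {Γ : Globalization σ G M}
  {β : H →* (N ≃ₗ[ℤ] N)} {c : OrbitCocycle Γ (AffineGroup β)}

/-- Near `0` in `Q` the components have bounded exponent `n`. For each divisor `l > 1` of `n`, (ii₁)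
excludes order `l` on a smaller constructible subgroup; only finitely many shrinkings are needed. -/
theorem OrbitCocycle.TorsionTranslations.exists_right_eq_one_of_condII1
    (hc : c.TorsionTranslations) [IsAddTorsionFree A] {P : Submodule ℤ A} (hP : FiniteRank P)
    (hII : CondII1 σ H P hP) {Q : Submodule ℤ A} (hQ : Q.FG)
    (hinv : ∀ s, Q.map (σ.toEnd s) ≤ Q) (hQP : Q ≤ P) :
    ∃ C, Constructible σ C ∧ Q ≤ c.per C ∧ ∀ a ∈ C ⊓ Q, (c.trans a 0).right = 1 := by
  obtain ⟨C₀, hC₀, hQC⟩ := c.exists_le_per hQ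
  have hstab : C₀ ⊓ Q ≤ c.stab C₀ := fun a ha => ⟨hQC ha.2, ha.1⟩
  have hfg : (C₀ ⊓ Q).FG := by
    have : Module.Finite ℤ Q := Module.Finite.iff_fg.2 hQ
    exact Submodule.FG.of_le hQ inf_le_right
  obtain ⟨n, hn, hexp⟩ := hc.exists_exponent hC₀ hfg hstab
  obtain ⟨D, hD, h⟩ := Constructible.exists_forall_finset (σ := σ) n.divisors
    (fun l D => ∀ a ∈ D ⊓ (C₀ ⊓ Q), orderOf (c.trans a 0).right = l → l = 1)
    (fun l C D hDC h a ha => h a ⟨hDC ha.1, ha.2⟩) fun l hl => by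
      by_cases hl1 : 1 < l
      swap
      · have := Nat.pos_of_mem_divisors hl
        exact ⟨⊤, .top, fun _ _ _ => by omega⟩
      by_cases hord : ∃ a : H, orderOf a = l
      swap
      · exact ⟨⊤, .top, fun a _ ha => (hord ⟨_, ha⟩).elim⟩
      obtain ⟨s, -, μ, ν, hμ, hν, hcop, hs, ⟨δ, hδ⟩, hgcd⟩ := hII l hl1 hord
      obtain ⟨E, hE, hconj⟩ := c.conj (Γ.ι (s ^ δ))
      refine ⟨C₀.comap (σ.toEnd (s ^ δ)) ⊓ E, (hC₀.preimage _).inf hE, fun a ha hal => ?_⟩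
      -- From `μ σ_s^δ a = ν a` the `μ`-th power of the component is conjugate to its `ν`-th power.
      have heq := nsmul_pow_eq_nsmul_of_charpoly hP hs hδ (hQP ha.2.2)
      have ha' : σ.toEnd (s ^ δ) a ∈ c.stab C₀ :=
        hstab ⟨ha.1.1, hinv _ ⟨a, ha.2.2, rfl⟩⟩
      have h1 := hconj a ha.1.2 _ (Γ.act_ι (s ^ δ) a)
      rw [← eq_mul_inv_iff_mul_eq] at h1
      have h2 := congrArg (fun x => c.trans x 0) heq
      simp only [c.trans_nsmul ha', c.trans_nsmul (hstab ha.2), h1, conj_pow] at h2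
      have h3 := congrArg SemidirectProduct.rightHom h2
      simp only [map_mul, map_pow, map_inv, SemidirectProduct.rightHom_eq_right] at h3
      obtain ⟨γ, h3⟩ : ∃ γ, γ * (c.trans a 0).right ^ μ * γ⁻¹ = (c.trans a 0).right ^ ν :=
        ⟨_, h3⟩
      -- Conjugate powers have equal orders, so the two gcds agree; since `μ` and `ν` are coprime
      -- both are `1`, contrary to (ii₁).
      have h4 : l / l.gcd μ = l / l.gcd ν := by
        have : orderOf ((c.trans a 0).right ^ μ) = orderOf ((c.trans a 0).right ^ ν) := by
          rw [← h3]
          exact (orderOf_injective (MulAut.conj γ).toMonoidHom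
            (MulAut.conj γ).injective _).symm
        rwa [orderOf_pow' _ hμ.ne', orderOf_pow' _ hν.ne', hal] at this
      have h5 : l.gcd μ = l.gcd ν := by
        have e1 := Nat.div_mul_cancel (Nat.gcd_dvd_left l μ)
        have e2 := Nat.div_mul_cancel (Nat.gcd_dvd_left l ν)
        rw [h4] at e1
        refine Nat.eq_of_mul_eq_mul_left ?_ (e1.trans e2.symm)
        exact Nat.div_pos (Nat.gcd_le_left _ (by omega)) (Nat.gcd_pos_of_pos_left _ (by omega))
      have h6 : l.gcd μ = 1 :=
        Nat.eq_one_of_dvd_coprimes hcop (Nat.gcd_dvd_right l μ) (h5 ▸ Nat.gcd_dvd_right l ν)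
      rw [← h5, h6] at hgcd
      omega
  refine ⟨C₀ ⊓ D, hC₀.inf hD, hQC.trans (c.per_anti inf_le_left), fun a ha => ?_⟩
  have haQ : a ∈ C₀ ⊓ Q := ⟨ha.1.1, ha.2⟩
  refine orderOf_eq_one_iff.1 (h _ ?_ a ⟨ha.1.2, haQ⟩ rfl)
  exact Nat.mem_divisors.2 ⟨orderOf_dvd_iff_pow_eq_one.2 (hexp a haQ), hn.ne'⟩

theorem OrbitCocycle.TorsionTranslations.nonempty_embedding (hc : c.TorsionTranslations)
    (hΓ : Standing Γ) [IsAddTorsionFree M] [IsAddTorsionFree N] {P : ℕ → Submodule ℤ A}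
    (hP : Exhausts P)
    (hpure : ∀ k, ∃ C, Constructible σ C ∧ P k ≤ c.per C ∧
      ∀ a ∈ C ⊓ P k, (c.trans a 0).right = 1)
    (hinv : ∀ s k, (P k).map (σ.toEnd s) ≤ P k) (hpc : CondPC σ) :
    Nonempty (ActionEmbedding Γ.act β) := by
  obtain ⟨f, hf, heq, hfa⟩ := hc.exists_hom hΓ.finite_index
  have hact : ∀ (h : H) (z : N), rat β h (1 ⊗ₜ[ℤ] z) = 1 ⊗ₜ[ℤ] β h z := fun _ _ => rfl
  have hA : ∀ a, ∃ z, f (Γ.j a) = 1 ⊗ₜ[ℤ] z := by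
    intro a
    obtain ⟨k, hk⟩ := hP.2 a
    obtain ⟨C, hC, hper, h1⟩ := hpure k
    -- By (PC) a single `s` brings `a` into `C`, where the map is integral; acting by the inverse of
    -- the image of `s` preserves `N`.
    obtain ⟨s, hs⟩ := hpc C hC
    have hsC : σ.toEnd s a ∈ C := hs ⟨a, rfl⟩
    have hsP : σ.toEnd s a ∈ P k := hinv s k ⟨a, hk, rfl⟩
    have h2 := hfa C hC _ ⟨hper hsP, hsC⟩ (h1 _ ⟨hsC, hsP⟩)
    rw [← Γ.act_ι, heq] at h2
    refine ⟨β (c.lin (Γ.ι s)).right⁻¹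
      (Multiplicative.toAdd (c.trans (σ.toEnd s a) 0).left), ?_⟩
    rw [← hact, ← h2, ← LinearEquiv.mul_apply, ← map_mul, inv_mul_cancel, map_one]
    rfl
  -- Equivariance carries integrality from `A` to its translates, which generate `M`.
  have hM : ∀ x, ∃ z, f x = 1 ⊗ₜ[ℤ] z := by
    intro x
    have hx : x ∈ Submodule.span ℤ {x : M | ∃ g a, x = Γ.act g (Γ.j a)} := by
      rw [Γ.span_eq_top]; trivial
    induction hx using Submodule.span_induction with
    | mem x hx =>
      obtain ⟨g, a, rfl⟩ := hx
      obtain ⟨z, hz⟩ := hA a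
      exact ⟨_, by rw [heq, hz, hact]⟩
    | zero => exact ⟨0, by simp⟩
    | add x y _ _ hx hy =>
      obtain ⟨z, hz⟩ := hx
      obtain ⟨w, hw⟩ := hy
      exact ⟨z + w, by rw [map_add, hz, hw, TensorProduct.tmul_add]⟩
    | smul n x _ hx =>
      obtain ⟨z, hz⟩ := hx
      exact ⟨n • z, by rw [map_zsmul, hz, TensorProduct.tmul_smul]⟩
  choose b hb using hM
  have heqb : ∀ g x, b (Γ.act g x) = β (c.grpHom g) (b x) := fun g x =>
    tmul_one_injective (by
      change (1 : ℚ) ⊗ₜ[ℤ] _ = 1 ⊗ₜ[ℤ] _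
      rw [← hb, heq, hb, hact]; rfl)
  have hbinj : Function.Injective b := fun x y h => hf (by rw [hb, hb, h])
  refine ⟨⟨c.grpHom, ?_, AddMonoidHom.mk' b fun x y => tmul_one_injective ?_, hbinj, heqb⟩⟩
  · exact OrbitCocycle.grpHom_injective (r := fun h v => β h v) hΓ (fun v => by simp) hbinj heqb
  · change (1 : ℚ) ⊗ₜ[ℤ] _ = 1 ⊗ₜ[ℤ] _
    rw [TensorProduct.tmul_add, ← hb, ← hb, ← hb, map_add]

end Integral

/-! ### Embeddings obtained from a groupoid isomorphism -/

section Isomorphism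

variable {S A G M T B H N : Type*} [Monoid S] [AddCommGroup A] [Group G] [AddCommGroup M]
  [Monoid T] [AddCommGroup B] [Group H] [AddCommGroup N]
  {σ : AlgebraicAction S A} {τ : AlgebraicAction T B} {Γ : Globalization σ G M}
  {Δ : Globalization τ H N}

theorem nonempty_ratEmbedding_of_condI (hΓ : Standing Γ) [IsAddTorsionFree M] [IsAddTorsionFree N]
    (Φ : PartialAction.GroupoidIso Γ.partialAction Δ.partialAction) (hI : CondI σ H) :
    Nonempty (ActionEmbedding (rat Γ.act) (rat Δ.act)) := by
  have := Γ.isAddTorsionFree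
  obtain ⟨P, hP, hfr, hI⟩ := hI
  exact (OrbitCocycle.torsionTranslations_of_condIFor (c := Γ.orbitCocycle hΓ.finite_index Φ)
    hΓ.finite_index hP hfr hI).nonempty_ratEmbedding hΓ

theorem nonempty_embedding_of_condStar (hΓ : Standing Γ) (hΔ : Standing Δ) [IsAddTorsionFree M]
    [IsAddTorsionFree N] (Φ : PartialAction.GroupoidIso Γ.partialAction Δ.partialAction)
    (h : CondStar Γ Δ) : Nonempty (ActionEmbedding Γ.act Δ.act) := by
  have := Γ.isAddTorsionFree
  set c := Γ.orbitCocycle hΓ.finite_index Φ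
  obtain ⟨Q, hQ, hfg, hinv⟩ := h.exhaustion
  have hF : CondF Δ.act → c.TorsionTranslations → ∀ k, ∃ C, Constructible σ C ∧ Q k ≤ c.per C ∧
      ∀ a ∈ C ⊓ Q k, (c.trans a 0).right = 1 := by
    intro hF hc k
    obtain ⟨C, hC, hper⟩ := c.exists_le_per (hfg k)
    exact ⟨C, hC, hper, fun a ha => hc.right_eq_one_of_condF hF hC ⟨hper ha.2, ha.1⟩⟩
  rcases h.cond with ⟨P, hP, hfr, hI, hII⟩ | hIII
  · have hc := OrbitCocycle.torsionTranslations_of_condIFor (c := c) hΓ.finite_index hP hfr hI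
    refine hc.nonempty_embedding hΓ hQ ?_ hinv h.pc
    rcases hII with hII | ⟨hII, -⟩
    · intro k
      -- The invariant finitely generated exhaustion and the finite rank exhaustion are unrelated;
      -- finite generation places each `Q k` inside some `P n`.
      obtain ⟨n, hn⟩ := hP.exists_le (hfg k)
      exact hc.exists_right_eq_one_of_condII1 (hfr n) (hII n) (hfg k) (fun s => hinv s k) hn
    · exact hF hII hc
  · have hc := OrbitCocycle.torsionTranslations_of_condIII (c := c) hΓ hΔ.act_injective hIII
    exact hc.nonempty_embedding hΓ hQ (hF hIII.2.2 hc) hinv h.pc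

end Isomorphism

/-! ### Mutual embeddings in finite rank -/

section MutualEmbeddings

variable {G M H N : Type*} [Group G] [AddCommGroup M] [Group H] [AddCommGroup N]
  {α : G →* (M ≃ₗ[ℤ] M)} {β : H →* (N ≃ₗ[ℤ] N)}

/-- Additive maps between rational vector spaces are `ℚ`-linear, so injections both ways equate the
dimensions. -/
theorem ActionEmbedding.isFull_of_finiteRank (hM : FiniteRank M) (hN : FiniteRank N)
    (e : ActionEmbedding (rat α) (rat β)) (e' : ActionEmbedding (rat β) (rat α)) :
    e.IsFull := by
  have : Module.Finite ℚ (ℚ ⊗[ℤ] M) := hM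
  have : Module.Finite ℚ (ℚ ⊗[ℤ] N) := hN
  have h1 := LinearMap.finrank_le_finrank_of_injective (f := e.mod.toRatLinearMap)
    e.mod_injective
  have h2 := LinearMap.finrank_le_finrank_of_injective (f := e'.mod.toRatLinearMap)
    e'.mod_injective
  exact (LinearMap.injective_iff_surjective_of_finrank_eq_finrank
    (f := e.mod.toRatLinearMap) (h1.antisymm h2)).1 e.mod_injective

theorem ActionEmbedding.isStrict_of_leftInverse {R : Type*} [CommRing R] [Module R M] [Module R N]
    {α : G →* (M ≃ₗ[R] M)} {β : H →* (N ≃ₗ[R] N)} (e : ActionEmbedding α β)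
    (e' : ActionEmbedding β α) (h : ∀ s, e'.grp (e.grp s) = s) :
    e.IsStrict ∧ e'.IsStrict := by
  have h' : Function.Surjective e'.grp := fun s => ⟨_, h s⟩
  refine ⟨⟨e.grp_injective, fun t => ⟨e'.grp t, e'.grp_injective (h _)⟩⟩, e'.grp_injective, h'⟩

/-- The composite of the two module maps is an automorphism `ρ` conjugating the action of `s` to
that of `e'.grp (e.grp s)`. -/
theorem CondSF.leftInverse_of_rat (hSF : CondSF α) (e : ActionEmbedding (rat α) (rat β))
    (e' : ActionEmbedding (rat β) (rat α)) (he : e.IsFull) (he' : e'.IsFull) (s : G) :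
    e'.grp (e.grp s) = s := by
  let ρ : (ℚ ⊗[ℤ] M) ≃ₗ[ℚ] (ℚ ⊗[ℤ] M) :=
    LinearEquiv.ofBijective (e'.mod.comp e.mod).toRatLinearMap
      ⟨e'.mod_injective.comp e.mod_injective, he'.comp he⟩
  refine hSF _ _ ρ ?_
  rw [eq_mul_inv_iff_mul_eq]
  ext x
  change rat α (e'.grp (e.grp s)) (e'.mod (e.mod x)) = e'.mod (e.mod (rat α s x))
  rw [e.equivariant, e'.equivariant]

/-- The composite need not be onto `M`, but in finite rank its base change to `ℚ` is an
automorphism, to which (SF) applies. -/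
theorem CondSF.leftInverse [IsAddTorsionFree M] (hM : FiniteRank M) (hSF : CondSF α)
    (e : ActionEmbedding α β) (e' : ActionEmbedding β α) (s : G) : e'.grp (e.grp s) = s := by
  have : Module.Finite ℚ (ℚ ⊗[ℤ] M) := hM
  let f : Module.End ℤ M := (e'.mod.comp e.mod).toIntLinearMap
  have hf : Function.Injective f := e'.mod_injective.comp e.mod_injective
  have hinj : Function.Injective (LinearMap.baseChange ℚ f) :=
    Module.Flat.lTensor_preserves_injective_linearMap (M := ℚ) f hf
  let ρ := LinearEquiv.ofInjectiveEndo (LinearMap.baseChange ℚ f) hinj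
  refine hSF _ _ ρ ?_
  rw [eq_mul_inv_iff_mul_eq]
  apply LinearEquiv.toLinearMap_injective
  apply TensorProduct.AlgebraTensorModule.curry_injective
  ext x
  change (1 : ℚ) ⊗ₜ[ℤ] α (e'.grp (e.grp s)) (e'.mod (e.mod x)) =
    1 ⊗ₜ[ℤ] e'.mod (e.mod (α s x))
  rw [e.equivariant, e'.equivariant]

/-- The range of `e.mod` contains that of the injective endomorphism `e.mod ∘ e'.mod` of `N`. -/
theorem ActionEmbedding.isFiniteIndex [IsAddTorsionFree N] (hN : FiniteRank N)
    (e : ActionEmbedding α β) (e' : ActionEmbedding β α) : e.IsFiniteIndex := by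
  have h := finiteIndex_range_of_injective hN (e.mod.comp e'.mod)
    (e.mod_injective.comp e'.mod_injective)
  refine AddSubgroup.finiteIndex_of_le (H := (e.mod.comp e'.mod).range) ?_
  rintro _ ⟨x, rfl⟩
  exact ⟨e'.mod x, rfl⟩

end MutualEmbeddings

end

end AlgAct

theorem theorem3 {S A T B G M H N : Type*}
    [Monoid S] [AddCommGroup A] [Group G] [AddCommGroup M]
    [Monoid T] [AddCommGroup B] [Group H] [AddCommGroup N]
    (σ : AlgebraicAction S A) (τ : AlgebraicAction T B)
    (Γ : Globalization σ G M) (Δ : Globalization τ H N)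
    (hΓ : Standing Γ) (hΔ : Standing Δ)
    (hM : IsAddTorsionFree M) (hN : IsAddTorsionFree N)
    (hiso : Nonempty (PartialAction.GroupoidIso Γ.partialAction Δ.partialAction)) :
    (CondIs Γ Δ →
      MutEmb (rat Γ.act) (rat Δ.act) ∧
      (FiniteRank M → FiniteRank N →
        MutEmbFull (rat Γ.act) (rat Δ.act) ∧
        (CondSF Γ.act → CondSF Δ.act → FullStrictEmb (rat Γ.act) (rat Δ.act)))) ∧
    (CondStars Γ Δ →
      MutEmb Γ.act Δ.act ∧
      (FiniteRank M → FiniteRank N →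
        MutEmbFI Γ.act Δ.act ∧
        (CondSF Γ.act → CondSF Δ.act → FinitelyAlgEquiv Γ.act Δ.act))) := by
  obtain ⟨Φ⟩ := hiso
  constructor
  · rintro ⟨hI, hI'⟩
    obtain ⟨e⟩ := nonempty_ratEmbedding_of_condI hΓ Φ hI
    obtain ⟨e'⟩ := nonempty_ratEmbedding_of_condI hΔ Φ.symm hI'
    refine ⟨⟨⟨e⟩, ⟨e'⟩⟩, fun hMr hNr => ?_⟩
    have he := e.isFull_of_finiteRank hMr hNr e'
    have he' := e'.isFull_of_finiteRank hNr hMr e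
    exact ⟨⟨⟨e, he⟩, ⟨e', he'⟩⟩, fun hSF _ =>
      ⟨e, (e.isStrict_of_leftInverse e' (hSF.leftInverse_of_rat e e' he he')).1, he⟩⟩
  · rintro ⟨h, h'⟩
    obtain ⟨e⟩ := nonempty_embedding_of_condStar hΓ hΔ Φ h
    obtain ⟨e'⟩ := nonempty_embedding_of_condStar hΔ hΓ Φ.symm h'
    refine ⟨⟨⟨e⟩, ⟨e'⟩⟩, fun hMr hNr => ?_⟩
    have he := e.isFiniteIndex hNr e'
    have he' := e'.isFiniteIndex hMr e
    refine ⟨⟨⟨e, he⟩, ⟨e', he'⟩⟩, fun hSF _ => ?_⟩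
    have hs := e.isStrict_of_leftInverse e' (hSF.leftInverse hMr e e')
    exact ⟨⟨e, hs.1, he⟩, ⟨e', hs.2, he'⟩⟩
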